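/- Fix a countably infinite set of propositional variables $\mathbb P=\{p_0,p_1,p_2,\dots\}$ and let ${\sf L}$ be the set of formulas $$\varphi,\psi ::= p \mid \bot \mid (\varphi\wedge\psi) \mid (\varphi\vee\psi) \mid (\varphi\to\psi) \mid (\bigcirc\varphi) \mid (\Diamond\varphi) \mid (\Box\varphi) \mid (\varphi\mathbin{\sf U}\psi) \mid (\varphi\mathbin{\sf R}\psi)\qquad (p\in\mathbb P).$$ An intuitionistic dynamic model is a tuple $M=(W,\preccurlyeq,S,V)$ where $W$ is a non-empty set, $\preccurlyeq$ is a partial order on $W$, $S\colon W\to W$ satisfies $w\preccurlyeq v\Rightarrow S(w)\preccurlyeq S(v)$, and $V\colon W\to\mathcal P(\mathbb P)$ satisfies $w\preccurlyeq v\Rightarrow V(w)\subseteq V(v)$. Satisfaction is defined by: - $M,w\models p$ iff $p\in V(w)$; $M,w\not\models\bot$; $\wedge$ and $\vee$ are interpreted as conjunction and disjunction at $w$; - $M,w\models\varphi\to\psi$ iff for all $v\succcurlyeq w$, $M,v\models\varphi$ implies $M,v\models\psi$; - $M,w\models\bigcirc\varphi$ iff $M,S(w)\models\varphi$; - $M,w\models\Diamond\varphi$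 (resp. $\Box\varphi$) iff $M,S^k(w)\models\varphi$ for some (resp. every) $k\ge 0$; - $M,w\models\varphi\mathbin{\sf U}\psi$ iff there is $k\ge0$ with $M,S^k(w)\models\psi$ and $M,S^i(w)\models\varphi$ for all $0\le i<k$; - $M,w\models\varphi\mathbin{\sf R}\psi$ iff for every $k\ge0$, either $M,S^k(w)\models\psi$ or $M,S^i(w)\models\varphi$ for some $0\le i<k$. A formula is satisfiable for ${\sf ITL^e}$ if it is satisfied at some world of some intuitionistic dynamic model, and valid for ${\sf ITL^e}$ if it is satisfied at every world of every intuitionistic dynamic model. Then the satisfiability problem and the validity problem for ${\sf ITL^e}$ are both decidable: each of the sets $\{\varphi\in{\sf L}:\varphi\text{ is satisfiable}\}$ and $\{\varphi\in{\sf L}:\varphi\text{ is valid}\}$ is computable, formulas being given to algorithms by an effective Gödel numbering. -/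

import Mathlib

universe u

namespace ITL

/-- Formulas of the language `L`, over the propositional variables `p₀, p₁, p₂, …`. -/
inductive Formula : Type
  | var (p : ℕ) : Formula
  | bot : Formula
  | and (φ ψ : Formula) : Formula
  | or (φ ψ : Formula) : Formula
  | imp (φ ψ : Formula) : Formula
  | next (φ : Formula) : Formula
  | eventually (φ : Formula) : Formula
  | henceforth (φ : Formula) : Formula
  | untl (φ ψ : Formula) : Formula
  | release (φ ψ : Formula) : Formula

/-- A dynamic poset on a nonempty set `W` of states: a partial order together with a function
`S` that is forward confluent, i.e. `w ≼ v` implies `S w ≼ S v`. -/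
structure DynamicPoset (W : Type u) [Nonempty W] [PartialOrder W] where
  S : W → W
  confluent : ∀ w v : W, w ≤ v → S w ≤ S v

/-- An intuitionistic dynamic model: a dynamic poset with a monotone valuation. -/
structure Model (W : Type u) [Nonempty W] [PartialOrder W] extends DynamicPoset W where
  V : W → Set ℕ
  monotone : ∀ w v : W, w ≤ v → V w ⊆ V v

/-- The satisfaction relation. -/
def Model.Sat {W : Type u} [Nonempty W] [PartialOrder W] (M : Model W) : W → Formula → Prop
  | w, .var p => p ∈ M.V w
  | _, .bot => False
  | w, .and φ ψ => M.Sat w φ ∧ M.Sat w ψ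
  | w, .or φ ψ => M.Sat w φ ∨ M.Sat w ψ
  | w, .imp φ ψ => ∀ v : W, w ≤ v → M.Sat v φ → M.Sat v ψ
  | w, .next φ => M.Sat (M.S w) φ
  | w, .eventually φ => ∃ k : ℕ, M.Sat (M.S^[k] w) φ
  | w, .henceforth φ => ∀ k : ℕ, M.Sat (M.S^[k] w) φ
  | w, .untl φ ψ => ∃ k : ℕ, M.Sat (M.S^[k] w) ψ ∧ ∀ i < k, M.Sat (M.S^[i] w) φ
  | w, .release φ ψ => ∀ k : ℕ, M.Sat (M.S^[k] w) ψ ∨ ∃ i < k, M.Sat (M.S^[i] w) φ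

/-- Satisfiability for `ITLᵉ`: truth at some world of some intuitionistic dynamic model. -/
def Formula.Satisfiable (φ : Formula) : Prop :=
  ∃ (W : Type u) (_ : Nonempty W) (_ : PartialOrder W) (M : Model W) (w : W), M.Sat w φ

/-- Validity for `ITLᵉ`: truth at every world of every intuitionistic dynamic model. -/
def Formula.Valid (φ : Formula) : Prop :=
  ∀ (W : Type u) [Nonempty W] [PartialOrder W] (M : Model W) (w : W), M.Sat w φ

/-- The Gödel number of a formula. -/
def Formula.code : Formula → ℕ
  | .bot => 0
  | .var p => 9 * p + 1
  | .and φ ψ => 9 * Nat.pair φ.code ψ.code + 2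
  | .or φ ψ => 9 * Nat.pair φ.code ψ.code + 3
  | .imp φ ψ => 9 * Nat.pair φ.code ψ.code + 4
  | .untl φ ψ => 9 * Nat.pair φ.code ψ.code + 5
  | .release φ ψ => 9 * Nat.pair φ.code ψ.code + 6
  | .next φ => 9 * φ.code + 7
  | .eventually φ => 9 * φ.code + 8
  | .henceforth φ => 9 * φ.code + 9

/-- The formula with a given Gödel number. -/
def Formula.ofCode : ℕ → Formula
  | 0 => .bot
  | n + 1 =>
    have h : n / 9 < n + 1 := Nat.lt_succ_of_le (Nat.div_le_self n 9)
    have _h₁ : (n / 9).unpair.1 < n + 1 := lt_of_le_of_lt (Nat.unpair_left_le _) h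
    have _h₂ : (n / 9).unpair.2 < n + 1 := lt_of_le_of_lt (Nat.unpair_right_le _) h
    match n % 9 with
    | 0 => .var (n / 9)
    | 1 => .and (ofCode (n / 9).unpair.1) (ofCode (n / 9).unpair.2)
    | 2 => .or (ofCode (n / 9).unpair.1) (ofCode (n / 9).unpair.2)
    | 3 => .imp (ofCode (n / 9).unpair.1) (ofCode (n / 9).unpair.2)
    | 4 => .untl (ofCode (n / 9).unpair.1) (ofCode (n / 9).unpair.2)
    | 5 => .release (ofCode (n / 9).unpair.1) (ofCode (n / 9).unpair.2)
    | 6 => .next (ofCode (n / 9))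
    | 7 => .eventually (ofCode (n / 9))
    | _ => .henceforth (ofCode (n / 9))
  termination_by n => n

theorem Formula.ofCode_code (φ : Formula) : ofCode φ.code = φ := by
  have hd : ∀ m r : ℕ, r < 9 → (9 * m + r) / 9 = m := by intro m r hr; omega
  have hm : ∀ m r : ℕ, r < 9 → (9 * m + r) % 9 = r := by intro m r hr; omega
  induction φ with
  | bot => simp [code, ofCode]
  | var p => rw [code, ofCode]; simp
  | and φ ψ ih₁ ih₂ | or φ ψ ih₁ ih₂ | imp φ ψ ih₁ ih₂ | untl φ ψ ih₁ ih₂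
  | release φ ψ ih₁ ih₂ =>
    rw [code, ofCode, hd _ _ (by norm_num), hm _ _ (by norm_num)]
    simp [ih₁, ih₂]
  | next φ ih | eventually φ ih | henceforth φ ih =>
    rw [code, ofCode, hd _ _ (by norm_num), hm _ _ (by norm_num)]
    simp [ih]

theorem Formula.code_ofCode (n : ℕ) : (ofCode n).code = n := by
  induction n using Nat.strong_induction_on with
  | _ n ih =>
    cases n with
    | zero => simp [code, ofCode]
    | succ n =>
      have h : n / 9 < n + 1 := Nat.lt_succ_of_le (Nat.div_le_self n 9)
      have h₁ := ih _ (lt_of_le_of_lt (Nat.unpair_left_le (n / 9)) h)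
      have h₂ := ih _ (lt_of_le_of_lt (Nat.unpair_right_le (n / 9)) h)
      have h₀ := ih _ h
      have hn := Nat.div_add_mod n 9
      have hlt := Nat.mod_lt n (show 9 > 0 by norm_num)
      rw [ofCode]
      generalize hr : n % 9 = r at *
      interval_cases r <;> simp only [code, h₀, h₁, h₂, Nat.pair_unpair] <;> omega

/-- The Gödel numbering is a bijection. -/
def Formula.codeEquiv : Formula ≃ ℕ where
  toFun := code
  invFun := ofCode
  left_inv := ofCode_code
  right_inv := code_ofCode

/-- Algorithms receive a formula through its Gödel number. -/
instance : Primcodable Formula := Primcodable.ofEquiv ℕ Formula.codeEquiv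

end ITL

/-! A formula that is not valid fails in a finite model whose size has a primitive recursive bound,
and the search among models up to that size is primitive recursive. Satisfiability of `φ` is
non-validity of `φ → ⊥`.

Let `n` be the code of `φ`, and label every state of a countermodel by the formulas of code at most
`n` true there. Labels grow along the order, so a chain changes label at most `n + 1` times, and the
order above a state can be replaced by a finite tree of types in which all trees of bounded depth
over that state can be simulated (`exists_labTree`). The states of the new model are nodes of such
trees, and one step sends a tree over `r` into one over `S r` by a simulation. All local clauses
survive, but eventualities could be postponed forever.

So each tree carries a set of pending tasks, pairs of a node and a formula. Among all realizations
of the tree and all tasks, one with the least waiting time is followed. Given the label, being done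
in one step less is governed by an upper set (`Model.exists_upperSet_done`), so one further monotone
bit in the labels lets the simulation preserve it, and the least waiting time drops (`exists_next`).
All tasks are eventually cleared, and then all are loaded again (`exists_finite_quotient`). The
resulting labelling satisfies `Hintikka`, which makes it a model by the truth lemma
`Hintikka.sat_iff`. -/

namespace ITL

/-! ### Types of bounded depth over a monotone labelling -/

section Types

variable {M : Type u} [Preorder M] {L : Type}

/-- Iterated types over a set `L` of labels: a label together with a set of types of lower depth. -/
def Ty (L : Type) : ℕ → Type
  | 0 => L
  | d + 1 => L × Set (Ty L d)

instance Ty.finite [Finite L] : (d : ℕ) → Finite (Ty L d)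
  | 0 => inferInstanceAs (Finite L)
  | d + 1 => by
    have : Finite (Ty L d) := Ty.finite d
    exact inferInstanceAs (Finite (L × Set (Ty L d)))

/-- The type of depth `d` of a point: its label and the types of the points above it that carry a
different label. -/
def ty (lab : M → L) : (d : ℕ) → M → Ty L d
  | 0, v => lab v
  | d + 1, v => (lab v, {x | ∃ v', v ≤ v' ∧ lab v' ≠ lab v ∧ ty lab d v' = x})

theorem lab_eq_of_ty_eq {lab : M → L} : ∀ {d : ℕ} {a b : M}, ty lab d a = ty lab d b →
    lab a = lab b
  | 0, _, _, h => h
  | _ + 1, _, _, h => congrArg Prod.fst h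

variable [PartialOrder L] {lab : M → L} {rank : L → ℕ}

/-- Passing to a higher point with another label lowers the rank, so depth `d` already exhausts the
label changes above a point of rank at most `d`, and types stabilize. -/
theorem ty_succ_eq (hlab : Monotone lab) (hrank : StrictAnti rank) :
    ∀ {d : ℕ} {a b : M}, rank (lab a) ≤ d → ty lab d a = ty lab d b →
      ty lab (d + 1) a = ty lab (d + 1) b := by
  have key : ∀ {v v' : M}, v ≤ v' → lab v' ≠ lab v → rank (lab v') < rank (lab v) :=
    fun h hne => hrank (lt_of_le_of_ne (hlab h) hne.symm)
  intro d
  induction d with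
  | zero =>
    intro a b ha h
    have hl := lab_eq_of_ty_eq h
    refine Prod.ext hl (Set.ext fun x => ?_)
    constructor
    · rintro ⟨v', h1, h2, -⟩
      have := key h1 h2
      omega
    · rintro ⟨v', h1, h2, -⟩
      have := key h1 h2
      rw [← hl] at this
      omega
  | succ d ih =>
    intro a b ha h
    have hl := lab_eq_of_ty_eq h
    have hs : ∀ x, (∃ v', a ≤ v' ∧ lab v' ≠ lab a ∧ ty lab d v' = x) ↔
        ∃ v', b ≤ v' ∧ lab v' ≠ lab b ∧ ty lab d v' = x := fun x =>
      Set.ext_iff.1 (congrArg Prod.snd h) x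
    refine Prod.ext hl (Set.ext fun x => ?_)
    constructor
    · rintro ⟨v', h1, h2, rfl⟩
      obtain ⟨w, h3, h4, h5⟩ := (hs _).1 ⟨v', h1, h2, rfl⟩
      have := key h1 h2
      exact ⟨w, h3, h4, (ih (by omega) h5.symm).symm⟩
    · rintro ⟨v', h1, h2, rfl⟩
      obtain ⟨w, h3, h4, h5⟩ := (hs _).2 ⟨v', h1, h2, rfl⟩
      have := key h3 h4
      exact ⟨w, h3, h4, ih (by omega) h5⟩

/-- `b` is simulated by `a`, with respect to labels and types. -/
def Simulates {X : Type} (lab : M → L) (t : M → X) (a b : M) : Prop :=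
  lab a = lab b ∧ ∀ b', b ≤ b' → lab b' ≠ lab b → ∃ a', a ≤ a' ∧ lab a' ≠ lab a ∧ t a' = t b'

/-- At a depth that bounds all ranks, higher points are matched with the same full type. No depth is
lost, so the matching can be iterated. -/
theorem simulates_of_ty_eq (hlab : Monotone lab) (hrank : StrictAnti rank) {d : ℕ}
    (hd : ∀ l, rank l ≤ d) {a b : M} (h : ty lab d a = ty lab d b) :
    Simulates lab (ty lab d) a b := by
  refine ⟨lab_eq_of_ty_eq h, fun b' h1 h2 => ?_⟩
  have := congrArg Prod.snd (ty_succ_eq hlab hrank (hd _) h)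
  exact (Set.ext_iff.1 this (ty lab d b')).2 ⟨b', h1, h2, rfl⟩

end Types

/-! ### The canonical tree over a point and simulations in it -/

section Tree

variable {M : Type u} [Preorder M] {L X : Type}

/-- Some point above `v`, with another label, has type `x`. -/
def Admits (lab : M → L) (t : M → X) (v : M) (x : X) : Prop :=
  ∃ v', v ≤ v' ∧ lab v' ≠ lab v ∧ t v' = x

open Classical in
/-- A point above `v`, with another label and of type `x`, if there is one. -/
noncomputable def rep (lab : M → L) (t : M → X) (v : M) (x : X) : M :=
  if h : Admits lab t v x then h.choose else v

/-- The point represented by a node of the canonical tree with root `r`. A node is a list of types,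
and it lies below the lists that it is a suffix of. -/
noncomputable def node (lab : M → L) (t : M → X) (r : M) : List X → M
  | [] => r
  | x :: l => rep lab t (node lab t r l) x

/-- The nodes of the canonical tree with root `r`. -/
def IsNode (lab : M → L) (t : M → X) (r : M) : List X → Prop
  | [] => True
  | x :: l => IsNode lab t r l ∧ Admits lab t (node lab t r l) x

open Classical in
/-- The simulation of a labelled tree in the canonical tree. -/
noncomputable def sim (lab : M → L) (t : M → X) {Y : Type} (g : List Y → M) : List Y → List X
  | [] => []
  | y :: l => if lab (g (y :: l)) = lab (g l) then sim lab t g l else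
      t (g (y :: l)) :: sim lab t g l

variable {lab : M → L} {t : M → X} {r : M}

theorem rep_spec {v : M} {x : X} (h : Admits lab t v x) :
    v ≤ rep lab t v x ∧ lab (rep lab t v x) ≠ lab v ∧ t (rep lab t v x) = x := by
  rw [rep, dif_pos h]
  exact h.choose_spec

theorem IsNode.of_suffix {l l' : List X} (h : l <:+ l') (hl : IsNode lab t r l') :
    IsNode lab t r l := by
  induction l' with
  | nil => rw [List.suffix_nil.1 h]; trivial
  | cons x l' ih =>
    rcases List.suffix_cons_iff.1 h with rfl | h
    · exact hl
    · exact ih h hl.1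

theorem node_mono {l l' : List X} (h : l <:+ l') (hl : IsNode lab t r l') :
    node lab t r l ≤ node lab t r l' := by
  induction l' with
  | nil => rw [List.suffix_nil.1 h]
  | cons x l' ih =>
    rcases List.suffix_cons_iff.1 h with rfl | h
    · exact le_rfl
    · exact (ih h hl.1).trans (rep_spec hl.2).1

/-- Every entry of a node pays for a label change with rank; this bounds the height of the canonical
tree. -/
theorem IsNode.length_le [PartialOrder L] {rank : L → ℕ} (hlab : Monotone lab)
    (hrank : StrictAnti rank) : ∀ {l : List X}, IsNode lab t r l →
      rank (lab (node lab t r l)) + l.length ≤ rank (lab r)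
  | [], _ => le_rfl
  | x :: l, h => by
    have h1 := IsNode.length_le hlab hrank h.1
    have h2 := rep_spec h.2
    have h3 : rank (lab (node lab t r (x :: l))) < rank (lab (node lab t r l)) :=
      hrank (lt_of_le_of_ne (hlab h2.1) h2.2.1.symm)
    simp only [List.length_cons]
    omega

theorem exists_node_above (htl : ∀ a b, t a = t b → lab a = lab b) {l : List X}
    (hl : IsNode lab t r l) {v : M} (hv : node lab t r l ≤ v) :
    ∃ l', IsNode lab t r l' ∧ l <:+ l' ∧ lab (node lab t r l') = lab v := by
  by_cases h : lab v = lab (node lab t r l)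
  · exact ⟨l, hl, List.suffix_rfl, h.symm⟩
  · have had : Admits lab t (node lab t r l) (t v) := ⟨v, hv, h, rfl⟩
    exact ⟨t v :: l, ⟨hl, had⟩, List.suffix_cons _ _, htl _ _ (rep_spec had).2.2⟩

omit [Preorder M] in
theorem sim_mono {Y : Type} (g : List Y → M) {l l' : List Y} (h : l <:+ l') :
    sim lab t g l <:+ sim lab t g l' := by
  induction l' with
  | nil => rw [List.suffix_nil.1 h]
  | cons x l' ih =>
    rcases List.suffix_cons_iff.1 h with rfl | h
    · exact List.suffix_rfl
    · rw [sim]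
      split_ifs
      · exact ih h
      · exact (ih h).trans (List.suffix_cons _ _)

/-- A step that keeps the label leaves the canonical node in place, although fewer types may remain
above the new point; the one-sided relation `Simulates` survives this. At a label change the types
agree again. -/
theorem sim_spec {Y : Type} (ht : ∀ a b, t a = t b → Simulates lab t a b) {T : Set (List Y)}
    (hT : ∀ y l, y :: l ∈ T → l ∈ T) {g : List Y → M} (hg : ∀ y l, y :: l ∈ T → g l ≤ g (y :: l))
    {l : List Y} (hl : l ∈ T) :
    IsNode lab t (g []) (sim lab t g l) ∧
      Simulates lab t (node lab t (g []) (sim lab t g l)) (g l) := by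
  induction l with
  | nil => exact ⟨trivial, ht _ _ rfl⟩
  | cons y l ih =>
    obtain ⟨h1, h2⟩ := ih (hT _ _ hl)
    have h3 := hg _ _ hl
    by_cases h : lab (g (y :: l)) = lab (g l)
    · rw [sim, if_pos h]
      exact ⟨h1, h2.1.trans h.symm, fun b' h4 h5 => h2.2 b' (h3.trans h4) (h ▸ h5)⟩
    · rw [sim, if_neg h]
      have had : Admits lab t (node lab t (g []) (sim lab t g l)) (t (g (y :: l))) :=
        h2.2 _ h3 h
      exact ⟨⟨h1, had⟩, ht _ _ (rep_spec had).2.2⟩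

end Tree

/-! ### Labelled trees with pending tasks -/

section Configurations

/-- Lists of bounded length, the possible nodes of labelled trees. -/
abbrev Node (X : Type) (D : ℕ) : Type := {l : List X // l.length ≤ D}

/-- A labelled tree: its set of nodes and a labelling. -/
abbrev LabTree (X L : Type) (D : ℕ) : Type := Set (Node X D) × (Node X D → L)

/-- A labelled tree together with a set of pending tasks. -/
abbrev Config (X L E : Type) (D : ℕ) : Type := LabTree X L D × Set (Node X D × E)

variable {M : Type u} [Preorder M] {X L E : Type} {D : ℕ}

/-- The map `h` represents the nodes of the labelled tree `q` by points of `M`. -/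
structure Realizes (lab : M → L) (q : LabTree X L D) (h : List X → M) : Prop where
  root : ∀ y : Node X D, y.1 = [] → y ∈ q.1
  down : ∀ y z : Node X D, y.1 <:+ z.1 → z ∈ q.1 → y ∈ q.1
  lab_eq : ∀ y ∈ q.1, q.2 y = lab (h y.1)
  mono : ∀ y z : Node X D, y.1 <:+ z.1 → z ∈ q.1 → h y.1 ≤ h z.1
  above : ∀ y ∈ q.1, ∀ v, h y.1 ≤ v → ∃ z ∈ q.1, y.1 <:+ z.1 ∧ lab (h z.1) = lab v

/-- Labels extended by a truth value. -/
abbrev flag (lab : M → L) (U : Set M) (v : M) : L × Prop := (lab v, v ∈ U)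

open Classical in
/-- The rank of an extended label. -/
noncomputable def flagRank (rank : L → ℕ) (p : L × Prop) : ℕ :=
  rank p.1 + if p.2 then 0 else 1

theorem flagRank_strictAnti [PartialOrder L] {rank : L → ℕ} (hrank : StrictAnti rank) :
    StrictAnti (flagRank rank) := by
  rintro ⟨a, p⟩ ⟨b, q⟩ h
  rcases Prod.mk_lt_mk.1 h with ⟨h1, h2⟩ | ⟨h1, h2⟩
  · have := hrank h1
    have h3 : p → q := h2
    by_cases hp : p <;> by_cases hq : q <;> simp_all [flagRank]
    all_goals omega
  · have := hrank.antitone h1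
    obtain ⟨h3, h4⟩ := lt_iff_le_not_ge.1 h2
    have h3 : p → q := h3
    have h4 : ¬ (q → p) := h4
    by_cases hp : p <;> by_cases hq : q <;> simp_all [flagRank]

/-- For every point `r` there is a labelled tree with root `r` in which all trees of bounded depth
over `r` can be simulated, in such a way that membership in the upper set `U` is preserved. -/
theorem exists_labTree [PartialOrder L] {lab : M → L} (hlab : Monotone lab) {rank : L → ℕ}
    (hrank : StrictAnti rank) {s : ℕ} (hs : ∀ l, rank l ≤ s) {U : Set M} (hU : IsUpperSet U)
    (r : M) :
    ∃ (q : LabTree (Ty (L × Prop) (s + 1)) L (s + 1)) (h : List (Ty (L × Prop) (s + 1)) → M),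
      Realizes lab q h ∧ h [] = r ∧
      ∀ (q₀ : LabTree (Ty (L × Prop) (s + 1)) L (s + 1)) (g : List (Ty (L × Prop) (s + 1)) → M),
        (∀ y z : Node (Ty (L × Prop) (s + 1)) (s + 1), y.1 <:+ z.1 → z ∈ q₀.1 → y ∈ q₀.1) →
        (∀ y z : Node (Ty (L × Prop) (s + 1)) (s + 1), y.1 <:+ z.1 → z ∈ q₀.1 → g y.1 ≤ g z.1) →
        g [] = r →
        ∃ f : Node (Ty (L × Prop) (s + 1)) (s + 1) → Node (Ty (L × Prop) (s + 1)) (s + 1),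
          (∀ y ∈ q₀.1, f y ∈ q.1 ∧ lab (h (f y).1) = lab (g y.1) ∧
            (h (f y).1 ∈ U ↔ g y.1 ∈ U)) ∧
          ∀ y z : Node (Ty (L × Prop) (s + 1)) (s + 1), y.1 <:+ z.1 → z ∈ q₀.1 →
            (f y).1 <:+ (f z).1 := by
  classical
  have hlab' : Monotone (flag lab U) := fun a b hab => ⟨hlab hab, fun ha => hU hab ha⟩
  have hrank' := flagRank_strictAnti hrank
  have hs' : ∀ p, flagRank rank p ≤ s + 1 := by
    intro p
    have := hs p.1
    unfold flagRank
    split_ifs <;> omega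
  set t := ty (flag lab U) (s + 1) with ht
  have hsim : ∀ a b, t a = t b → Simulates (flag lab U) t a b := fun a b h =>
    simulates_of_ty_eq hlab' hrank' hs' h
  have hlen : ∀ l, IsNode (flag lab U) t r l → l.length ≤ s + 1 := fun l hl => by
    have h1 := hl.length_le hlab' hrank'
    have h2 := hs' (flag lab U r)
    omega
  -- The nodes come from the flagged labelling, but the tree records only the original labels, so
  -- the trees for all choices of `U` lie in one type that does not mention `U`.
  refine ⟨({y | IsNode (flag lab U) t r y.1}, fun y => lab (node (flag lab U) t r y.1)),
    node (flag lab U) t r, ⟨?_, ?_, ?_, ?_, ?_⟩, rfl, ?_⟩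
  · intro y hy
    change IsNode _ _ _ y.1
    rw [hy]
    trivial
  · exact fun y z hyz hz => IsNode.of_suffix hyz hz
  · exact fun y _ => rfl
  · exact fun y z hyz hz => node_mono hyz hz
  · intro y hy v hv
    obtain ⟨l', h1, h2, h3⟩ := exists_node_above (fun a b h => (hsim a b h).1) hy hv
    exact ⟨⟨l', hlen _ h1⟩, h1, h2, congrArg Prod.fst h3⟩
  · intro q₀ g hdown hmono hg
    have hspec : ∀ y ∈ q₀.1, _ := fun y hy => sim_spec (l := y.1) hsim (T := Subtype.val '' q₀.1)
      (g := g) (by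
        rintro x l ⟨⟨_, hlz⟩, hz, rfl⟩
        rw [List.length_cons] at hlz
        exact ⟨⟨l, by omega⟩, hdown ⟨l, _⟩ _ (List.suffix_cons _ _) hz, rfl⟩) (by
        rintro x l ⟨⟨_, hlz⟩, hz, rfl⟩
        rw [List.length_cons] at hlz
        exact hmono ⟨l, by omega⟩ _ (List.suffix_cons _ _) hz) ⟨y, hy, rfl⟩
    rw [hg] at hspec
    -- Outside `q₀` the simulating list may be too long; the root serves as a junk value there.
    refine ⟨fun y => if h : (sim (flag lab U) t g y.1).length ≤ s + 1 then
      ⟨sim (flag lab U) t g y.1, h⟩ else ⟨[], Nat.zero_le _⟩, ?_, ?_⟩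
    · intro y hy
      obtain ⟨h1, h2⟩ := hspec y hy
      beta_reduce
      rw [dif_pos (hlen _ h1)]
      exact ⟨h1, congrArg Prod.fst h2.1, iff_of_eq (congrArg Prod.snd h2.1)⟩
    · intro y z hyz hz
      beta_reduce
      rw [dif_pos (hlen _ (hspec y (hdown _ _ hyz hz)).1), dif_pos (hlen _ (hspec z hz).1)]
      exact sim_mono g hyz

variable (lab : M → L) (S : M → M) (don : E → L → Prop)

/-- The labelled tree is realized in `M` and the tasks concern its nodes. -/
def Admissible (c : Config X L E D) : Prop :=
  (∃ h, Realizes lab c.1 h) ∧ ∀ p ∈ c.2, p.1 ∈ c.1.1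

/-- Some task can be done within `k` steps. -/
def DoableIn (c : Config X L E D) (k : ℕ) : Prop :=
  ∃ p ∈ c.2, ∃ h, Realizes lab c.1 h ∧ ∃ j ≤ k, don p.2 (lab (S^[j] (h p.1.1)))

/-- The least time in which some task can be done. -/
noncomputable def delay (c : Config X L E D) : ℕ := sInf {k | DoableIn lab S don c k}

variable {lab S don}

/-- The successor must depend on the configuration alone, while its realization may be chosen anew
at every step; hence `delay` minimizes over realizations as well as tasks. A realization attaining
the minimum is moved by `S` and simulated with a flag for the chosen task, so the new delay is
smaller unless a task is done already. -/
theorem exists_next [PartialOrder L] (hlab : Monotone lab) (hS : Monotone S) {rank : L → ℕ}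
    (hrank : StrictAnti rank) {s : ℕ} (hs : ∀ l, rank l ≤ s)
    (hdon : ∀ e v, ∃ k, don e (lab (S^[k] v)))
    (hU : ∀ e k, ∃ U : Set M, IsUpperSet U ∧ ∀ v v', lab v = lab v' → (v ∈ U ↔ v' ∈ U) →
      (∃ j ≤ k, don e (lab (S^[j] v))) → ∃ j ≤ k, don e (lab (S^[j] v')))
    (c : Config (Ty (L × Prop) (s + 1)) L E (s + 1)) (hc : Admissible lab c) :
    ∃ (c' : Config (Ty (L × Prop) (s + 1)) L E (s + 1))
      (f : Node (Ty (L × Prop) (s + 1)) (s + 1) → Node (Ty (L × Prop) (s + 1)) (s + 1)),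
      Admissible lab c' ∧
      (∃ h, Realizes lab c.1 h ∧ ∀ y ∈ c.1.1, f y ∈ c'.1.1 ∧ c'.1.2 (f y) = lab (S (h y.1))) ∧
      (∀ y z : Node (Ty (L × Prop) (s + 1)) (s + 1), y.1 <:+ z.1 → z ∈ c.1.1 →
        (f y).1 <:+ (f z).1) ∧
      (c.2 = ∅ → ∀ y ∈ c'.1.1, ∀ e, (y, e) ∈ c'.2) ∧
      (c.2 ≠ ∅ → c'.2 = (fun p => (f p.1, p.2)) '' {p ∈ c.2 | ¬ don p.2 (c.1.2 p.1)} ∧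
        ((∃ p ∈ c.2, don p.2 (c.1.2 p.1)) ∨ delay lab S don c' < delay lab S don c)) := by
  rcases Set.eq_empty_or_nonempty c.2 with h0 | ⟨p₀, hp₀⟩
  · obtain ⟨h, hh⟩ := hc.1
    -- With nothing pending, the flag carries no information, and the new tree is loaded with every
    -- task at every node.
    obtain ⟨q, h', hq, -, hf⟩ := exists_labTree hlab hrank hs isUpperSet_univ (S (h []))
    obtain ⟨f, hf1, hf2⟩ := hf c.1 (fun l => S (h l)) hh.down (fun y z hyz hz =>
      hS (hh.mono y z hyz hz)) rfl
    refine ⟨(q, {p | p.1 ∈ q.1}), f, ⟨⟨h', hq⟩, fun p hp => hp⟩, ⟨h, hh, fun y hy => ?_⟩, hf2,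
      fun _ y hy e => hy, fun h => absurd h0 h⟩
    obtain ⟨h1, h2, -⟩ := hf1 y hy
    exact ⟨h1, (hq.lab_eq _ h1).trans h2⟩
  · have hne : {k | DoableIn lab S don c k}.Nonempty := by
      obtain ⟨h, hh⟩ := hc.1
      obtain ⟨k, hk⟩ := hdon p₀.2 (h p₀.1.1)
      exact ⟨k, p₀, hp₀, h, hh, k, le_rfl, hk⟩
    obtain ⟨p, hp, h, hh, j, hj, hdj⟩ : DoableIn lab S don c (delay lab S don c) :=
      Nat.sInf_mem hne
    -- Applying `S` spends one unit of time. Truncation at delay `0` is harmless, since the task is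
    -- then done now.
    obtain ⟨U, hUu, hUd⟩ := hU p.2 (delay lab S don c - 1)
    obtain ⟨q, h', hq, -, hf⟩ := exists_labTree hlab hrank hs hUu (S (h []))
    obtain ⟨f, hf1, hf2⟩ := hf c.1 (fun l => S (h l)) hh.down (fun y z hyz hz =>
      hS (hh.mono y z hyz hz)) rfl
    refine ⟨(q, (fun p => (f p.1, p.2)) '' {p ∈ c.2 | ¬ don p.2 (c.1.2 p.1)}), f,
      ⟨⟨h', hq⟩, ?_⟩, ⟨h, hh, fun y hy => ?_⟩, hf2, fun h => ?_, fun _ => ⟨rfl, ?_⟩⟩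
    · rintro _ ⟨p', ⟨hp', -⟩, rfl⟩
      exact (hf1 _ (hc.2 _ hp')).1
    · obtain ⟨h1, h2, -⟩ := hf1 y hy
      exact ⟨h1, (hq.lab_eq _ h1).trans h2⟩
    · rw [h] at hp₀
      exact hp₀.elim
    · by_cases hd : don p.2 (c.1.2 p.1)
      · exact Or.inl ⟨p, hp, hd⟩
      · right
        have hj0 : j ≠ 0 := by
          rintro rfl
          rw [hh.lab_eq _ (hc.2 _ hp)] at hd
          exact hd hdj
        obtain ⟨i, rfl⟩ := Nat.exists_eq_succ_of_ne_zero hj0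
        obtain ⟨h1, h2, h3⟩ := hf1 _ (hc.2 _ hp)
        obtain ⟨i', hi', hdi⟩ := hUd (S (h p.1.1)) (h' (f p.1).1) h2.symm h3.symm
          ⟨i, by omega, by rwa [Function.iterate_succ_apply] at hdj⟩
        have : delay lab S don (q, (fun p => (f p.1, p.2)) ''
            {p ∈ c.2 | ¬ don p.2 (c.1.2 p.1)}) ≤ delay lab S don c - 1 :=
          Nat.sInf_le ⟨(f p.1, p.2), ⟨p, ⟨hp, hd⟩, rfl⟩, h', hq, i', hi', hdi⟩
        omega

end Configurations

/-! ### The finite quotient -/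

section FiniteQuotient

variable {M : Type u} [Preorder M] {L E : Type}

/-- Iterating a step function on configurations that makes progress empties the set of tasks. -/
theorem exists_iterate_tasks_eq_empty {X : Type} [Finite X] [Finite E]
    {C : Type} (tasks : C → Set (X × E))
    (delay : C → ℕ) (next : C → C) (f : C → X → X) (P : C → X × E → Prop)
    (h : ∀ c, tasks c ≠ ∅ → tasks (next c) = (fun p => (f c p.1, p.2)) '' {p ∈ tasks c | ¬ P c p} ∧
      ((∃ p ∈ tasks c, P c p) ∨ delay (next c) < delay c)) (c : C) :
    ∃ n, tasks (next^[n] c) = ∅ := by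
  have fin : ∀ s : Set (X × E), s.Finite := fun s => s.toFinite
  -- Lexicographic descent: the number of tasks never grows, and if none is done the delay drops.
  suffices H : ∀ N d c, (tasks c).ncard ≤ N → delay c ≤ d → ∃ n, tasks (next^[n] c) = ∅ from
    H _ _ c le_rfl le_rfl
  intro N
  induction N with
  | zero =>
    intro d c hc _
    exact ⟨0, (Set.ncard_eq_zero (fin _)).1 (Nat.le_zero.1 hc)⟩
  | succ N ihN =>
    intro d
    induction d with
    | zero | succ d ihd =>
      intro c hc hd
      by_cases h0 : tasks c = ∅
      · exact ⟨0, h0⟩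
      obtain ⟨h1, h2⟩ := h c h0
      have h3 : (tasks (next c)).ncard ≤ {p ∈ tasks c | ¬ P c p}.ncard := by
        rw [h1]
        exact Set.ncard_image_le (fin _)
      rcases h2 with ⟨p, hp, hP⟩ | h2
      · have h4 : {p ∈ tasks c | ¬ P c p}.ncard < (tasks c).ncard :=
          Set.ncard_lt_ncard (Set.ssubset_iff_subset_ne.2 ⟨fun _ hq => hq.1, fun he =>
            (he.ge hp).2 hP⟩) (fin _)
        obtain ⟨n, hn⟩ := ihN (delay (next c)) (next c) (by omega) le_rfl
        exact ⟨n + 1, hn⟩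
      · first
        | omega
        | have h4 : {p ∈ tasks c | ¬ P c p}.ncard ≤ (tasks c).ncard :=
            Set.ncard_le_ncard (fun _ hq => hq.1) (fin _)
          obtain ⟨n, hn⟩ := ihd (next c) (by omega) (by omega)
          exact ⟨n + 1, hn⟩

/-- The order is a disjoint union of trees, one for each admissible configuration. Realizations of
successive configurations need not fit together: each state agrees with some point of `M` only in
its label, the next label and the labels above. This suffices for the local conditions, and the
tasks take care of fulfilment. -/
theorem exists_finite_quotient [PartialOrder L] [Finite L] [Finite E] {lab : M → L} {S : M → M}
    {don : E → L → Prop} (hlab : Monotone lab) (hS : Monotone S) {rank : L → ℕ}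
    (hrank : StrictAnti rank) {s : ℕ} (hs : ∀ l, rank l ≤ s)
    (hdon : ∀ e v, ∃ k, don e (lab (S^[k] v)))
    (hU : ∀ e k, ∃ U : Set M, IsUpperSet U ∧ ∀ v v', lab v = lab v' → (v ∈ U ↔ v' ∈ U) →
      (∃ j ≤ k, don e (lab (S^[j] v))) → ∃ j ≤ k, don e (lab (S^[j] v'))) (r : M) :
    ∃ (W : Type) (_ : PartialOrder W) (S' : W → W) (lab' : W → L) (w : W),
      (∃ i : W → Config (Ty (L × Prop) (s + 1)) L E (s + 1) × Node (Ty (L × Prop) (s + 1)) (s + 1),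
        Function.Injective i) ∧
      Monotone S' ∧ Monotone lab' ∧ lab' w = lab r ∧
      (∀ y, ∃ v, lab' y = lab v ∧ lab' (S' y) = lab (S v) ∧
        ∀ v', v ≤ v' → ∃ y', y ≤ y' ∧ lab' y' = lab v') ∧
      ∀ e y, ∃ k, don e (lab' (S'^[k] y)) := by
  have hX : Finite (Node (Ty (L × Prop) (s + 1)) (s + 1)) :=
    (List.finite_length_le (Ty (L × Prop) (s + 1)) (s + 1)).to_subtype
  have hnext := fun c : {c : Config (Ty (L × Prop) (s + 1)) L E (s + 1) // Admissible lab c} =>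
    exists_next hlab hS hrank hs hdon hU c.1 c.2
  choose next f hadm hreal hmono hempty hprog using hnext
  obtain ⟨q, h, hq, hr, -⟩ := exists_labTree hlab hrank hs isUpperSet_univ r
  let C := {c : Config (Ty (L × Prop) (s + 1)) L E (s + 1) // Admissible lab c}
  let nx : C → C := fun c => ⟨next c, hadm c⟩
  let W := {p : C × Node (Ty (L × Prop) (s + 1)) (s + 1) // p.2 ∈ p.1.1.1.1}
  let po : PartialOrder W :=
    { le := fun a b => a.1.1 = b.1.1 ∧ a.1.2.1 <:+ b.1.2.1
      le_refl := fun a => ⟨rfl, List.suffix_rfl⟩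
      le_trans := fun a b c hab hbc => ⟨hab.1.trans hbc.1, hab.2.trans hbc.2⟩
      le_antisymm := fun a b hab hba => Subtype.ext (Prod.ext hab.1 (Subtype.ext
        (hab.2.eq_of_length (le_antisymm hab.2.length_le hba.2.length_le)))) }
  let S' : W → W := fun p => ⟨(nx p.1.1, f p.1.1 p.1.2), by
    obtain ⟨h, -, h2⟩ := hreal p.1.1
    exact (h2 _ p.2).1⟩
  let lab' : W → L := fun p => p.1.1.1.1.2 p.1.2
  have hfst : ∀ n (p : W), (S'^[n] p).1.1 = nx^[n] p.1.1 := by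
    intro n
    induction n with
    | zero => exact fun _ => rfl
    | succ n ih => exact fun p => ih (S' p)
  have hclear : ∀ c : C, ∃ n, (nx^[n] c).1.2 = ∅ :=
    exists_iterate_tasks_eq_empty (fun c : C => c.1.2) (fun c => delay lab S don c.1) nx f
      (fun c p => don p.2 (c.1.1.2 p.1)) hprog
  -- A pending task follows its node along `f` and can leave the set only by being done.
  have htask : ∀ e n (p : W), (p.1.2, e) ∈ p.1.1.1.2 → (nx^[n] p.1.1).1.2 = ∅ →
      ∃ k, don e (lab' (S'^[k] p)) := by
    intro e n
    induction n with
    | zero =>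
      intro p hp hn
      have hn : p.1.1.1.2 = ∅ := hn
      rw [hn] at hp
      exact hp.elim
    | succ n ih =>
      intro p hp hn
      by_cases hd : don e (lab' p)
      · exact ⟨0, hd⟩
      · have hne : p.1.1.1.2 ≠ ∅ := fun h => by rw [h] at hp; exact hp.elim
        obtain ⟨k, hk⟩ := ih (S' p) (by
          change _ ∈ (next p.1.1).2
          rw [(hprog p.1.1 hne).1]
          exact ⟨(p.1.2, e), ⟨hp, hd⟩, rfl⟩) hn
        exact ⟨k + 1, hk⟩
  refine ⟨W, po, S', lab', ⟨(⟨(q, ∅), ⟨h, hq⟩, fun p hp => hp.elim⟩, ⟨[], Nat.zero_le _⟩),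
    hq.root _ rfl⟩, ⟨fun p => (p.1.1.1, p.1.2), fun a b hab => Subtype.ext (Prod.ext
      (Subtype.ext (Prod.mk.inj hab).1) (Prod.mk.inj hab).2)⟩, ?_, ?_, ?_, ?_, ?_⟩
  · rintro ⟨⟨c, y⟩, hy⟩ ⟨⟨c', z⟩, hz⟩ ⟨rfl : c = c', hyz⟩
    exact ⟨rfl, hmono c y z hyz hz⟩
  · rintro ⟨⟨c, y⟩, hy⟩ ⟨⟨c', z⟩, hz⟩ ⟨rfl : c = c', hyz⟩
    obtain ⟨h, hh, -⟩ := hreal c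
    change c.1.1.2 y ≤ c.1.1.2 z
    rw [hh.lab_eq _ hy, hh.lab_eq _ hz]
    exact hlab (hh.mono _ _ hyz hz)
  · exact (hq.lab_eq _ (hq.root _ rfl)).trans (congrArg lab hr)
  · rintro ⟨⟨c, y⟩, hy⟩
    obtain ⟨h, hh, h2⟩ := hreal c
    refine ⟨h y.1, hh.lab_eq _ hy, (h2 y hy).2, fun v' hv' => ?_⟩
    obtain ⟨z, hz, hyz, hl⟩ := hh.above y hy v' hv'
    exact ⟨⟨(c, z), hz⟩, ⟨rfl, hyz⟩, (hh.lab_eq _ hz).trans hl⟩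
  · intro e p
    -- Once the tasks are exhausted, the next step loads all tasks, among them `e` at the image of
    -- `p`; exhausting these fulfils it.
    obtain ⟨n, hn⟩ := hclear p.1.1
    obtain ⟨m, hm⟩ := hclear (S'^[n + 1] p).1.1
    obtain ⟨k, hk⟩ := htask e m (S'^[n + 1] p) (by
      rw [Function.iterate_succ_apply']
      refine hempty (S'^[n] p).1.1 ?_ _ ?_ e
      · rw [hfst]
        exact hn
      · exact (S' (S'^[n] p)).2) hm
    exact ⟨k + (n + 1), by rwa [Function.iterate_add_apply]⟩

end FiniteQuotient

/-! ### Local conditions and fulfilment of eventualities -/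

namespace Formula

theorem code_le_pair_left (a b r : ℕ) : a ≤ 9 * Nat.pair a b + r := by
  have := Nat.left_le_pair a b
  omega

theorem code_le_pair_right (a b r : ℕ) : b ≤ 9 * Nat.pair a b + r := by
  have := Nat.right_le_pair a b
  omega

/-- The eventuality expressed by a formula, if any, is fulfilled or void. -/
def Done (mem : Formula → Prop) : Formula → Prop
  | .eventually φ => mem φ ∨ ¬ mem (.eventually φ)
  | .henceforth φ => mem (.henceforth φ) ∨ ¬ mem φ
  | .untl φ ψ => mem ψ ∨ ¬ mem (.untl φ ψ)
  | .release φ ψ => mem (.release φ ψ) ∨ ¬ mem ψ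
  | _ => True

theorem done_congr {mem mem' : Formula → Prop} {ψ : Formula}
    (h : ∀ χ : Formula, χ.code ≤ ψ.code → (mem χ ↔ mem' χ)) : Done mem ψ ↔ Done mem' ψ := by
  cases ψ with
  | var | bot | and | or | imp | next => exact Iff.rfl
  | eventually φ | henceforth φ =>
    have h1 := h φ (by simp only [code]; omega)
    have h2 := h _ le_rfl
    simp only [Done, h1, h2]
  | untl φ ψ | release φ ψ =>
    have h1 := h ψ (code_le_pair_right _ _ _)
    have h2 := h _ le_rfl
    simp only [Done, h1, h2]

/-- The local conditions relating membership of a formula to membership of simpler formulas, at the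
same state, at the states above and at the next state. -/
def LocalAt {W : Type u} (le : W → W → Prop) (S : W → W) (mem : W → Formula → Prop) (w : W) :
    Formula → Prop
  | .var _ => True
  | .bot => ¬ mem w .bot
  | .and φ ψ => mem w (.and φ ψ) ↔ mem w φ ∧ mem w ψ
  | .or φ ψ => mem w (.or φ ψ) ↔ mem w φ ∨ mem w ψ
  | .imp φ ψ => mem w (.imp φ ψ) ↔ ∀ v, le w v → mem v φ → mem v ψ
  | .next φ => mem w (.next φ) ↔ mem (S w) φ
  | .eventually φ => mem w (.eventually φ) ↔ mem w φ ∨ mem (S w) (.eventually φ)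
  | .henceforth φ => mem w (.henceforth φ) ↔ mem w φ ∧ mem (S w) (.henceforth φ)
  | .untl φ ψ => mem w (.untl φ ψ) ↔ mem w ψ ∨ mem w φ ∧ mem (S w) (.untl φ ψ)
  | .release φ ψ => mem w (.release φ ψ) ↔ mem w ψ ∧ (mem w φ ∨ mem (S w) (.release φ ψ))

end Formula

open Formula

/-- A labelling by formulas of code at most `n` that satisfies all conditions of satisfaction. -/
structure Hintikka {W : Type u} (n : ℕ) (le : W → W → Prop) (S : W → W)
    (mem : W → Formula → Prop) : Prop where
  mono : ∀ w v ψ, ψ.code ≤ n → le w v → mem w ψ → mem v ψ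
  loc : ∀ w ψ, ψ.code ≤ n → LocalAt le S mem w ψ
  done : ∀ w ψ, ψ.code ≤ n → ∃ k, Done (mem (S^[k] w)) ψ

/-! ### The truth lemma -/

section Truth

variable {W : Type u} [Nonempty W] [PartialOrder W]

/-- The model given by a labelling. -/
def Hintikka.model {n : ℕ} {S : W → W} {mem : W → Formula → Prop}
    (H : Hintikka n (· ≤ ·) S mem) (hS : Monotone S) : Model W where
  S := S
  confluent := fun _ _ h => hS h
  V := fun w => {p | (Formula.var p).code ≤ n ∧ mem w (.var p)}
  monotone := fun _ _ h _ hp => ⟨hp.1, H.mono _ _ _ hp.1 h hp.2⟩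

/-- The local unfoldings do not single out the least fixed point for `◇`, `U` or the greatest for
`□`, `R`. Induction on a time at which `Done` holds settles both: a claimed `◇` or `U` must be
fulfilled by then, and membership of a true `□` or `R` is carried back from then. -/
theorem Hintikka.sat_iff {n : ℕ} {S : W → W} {mem : W → Formula → Prop}
    (H : Hintikka n (· ≤ ·) S mem) (hS : Monotone S) (ψ : Formula) (hψ : ψ.code ≤ n) (w : W) :
    (H.model hS).Sat w ψ ↔ mem w ψ := by
  induction ψ generalizing w with
  | var p => exact ⟨fun h => h.2, fun h => ⟨hψ, h⟩⟩
  | bot => exact ⟨False.elim, H.loc w .bot hψ⟩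
  | and φ ψ ih1 ih2 =>
    rw [show _ ↔ _ from H.loc w (.and φ ψ) hψ, Model.Sat,
      ih1 ((code_le_pair_left _ _ _).trans hψ), ih2 ((code_le_pair_right _ _ _).trans hψ)]
  | or φ ψ ih1 ih2 =>
    rw [show _ ↔ _ from H.loc w (.or φ ψ) hψ, Model.Sat,
      ih1 ((code_le_pair_left _ _ _).trans hψ), ih2 ((code_le_pair_right _ _ _).trans hψ)]
  | imp φ ψ ih1 ih2 =>
    rw [show _ ↔ _ from H.loc w (.imp φ ψ) hψ, Model.Sat]
    simp only [ih1 ((code_le_pair_left _ _ _).trans hψ),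
      ih2 ((code_le_pair_right _ _ _).trans hψ)]
  | next φ ih =>
    rw [show _ ↔ _ from H.loc w (.next φ) hψ, Model.Sat,
      ih (by simp only [code] at hψ; omega)]
    rfl
  | eventually φ ih =>
    have ih := ih (by simp only [code] at hψ; omega)
    have hl : ∀ w, mem w _ ↔ _ := fun w => H.loc w (.eventually φ) hψ
    simp only [Model.Sat, ih]
    constructor
    · rintro ⟨k, hk⟩
      induction k generalizing w with
      | zero => exact (hl w).2 (Or.inl hk)
      | succ k ihk => exact (hl w).2 (Or.inr (ihk _ hk))
    · intro hw
      obtain ⟨k, hk⟩ := H.done w _ hψ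
      induction k generalizing w with
      | zero => exact ⟨0, hk.resolve_right (not_not.2 hw)⟩
      | succ k ihk =>
        rcases (hl w).1 hw with h | h
        · exact ⟨0, h⟩
        · obtain ⟨j, hj⟩ := ihk _ h hk
          exact ⟨j + 1, hj⟩
  | henceforth φ ih =>
    have ih := ih (by simp only [code] at hψ; omega)
    have hl : ∀ w, mem w _ ↔ _ := fun w => H.loc w (.henceforth φ) hψ
    simp only [Model.Sat, ih]
    constructor
    · intro hw
      obtain ⟨k, hk⟩ := H.done w _ hψ
      induction k generalizing w with
      | zero => exact hk.resolve_right (not_not.2 (hw 0))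
      | succ k ihk => exact (hl w).2 ⟨hw 0, ihk _ (fun j => hw (j + 1)) hk⟩
    · intro hw k
      induction k generalizing w with
      | zero => exact ((hl w).1 hw).1
      | succ k ihk => exact ihk _ ((hl w).1 hw).2
  | untl φ ψ ih1 ih2 =>
    have ih1 := ih1 ((code_le_pair_left _ _ _).trans hψ)
    have ih2 := ih2 ((code_le_pair_right _ _ _).trans hψ)
    have hl : ∀ w, mem w _ ↔ _ := fun w => H.loc w (.untl φ ψ) hψ
    simp only [Model.Sat, ih1, ih2]
    constructor
    · rintro ⟨k, hk, hk'⟩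
      induction k generalizing w with
      | zero => exact (hl w).2 (Or.inl hk)
      | succ k ihk =>
        exact (hl w).2 (Or.inr ⟨hk' 0 k.succ_pos,
          ihk _ hk fun i hi => hk' (i + 1) (Nat.succ_lt_succ hi)⟩)
    · intro hw
      obtain ⟨k, hk⟩ := H.done w _ hψ
      induction k generalizing w with
      | zero => exact ⟨0, hk.resolve_right (not_not.2 hw), fun i hi => absurd hi i.not_lt_zero⟩
      | succ k ihk =>
        rcases (hl w).1 hw with h | ⟨h', h⟩
        · exact ⟨0, h, fun i hi => absurd hi i.not_lt_zero⟩
        · obtain ⟨j, hj, hj'⟩ := ihk _ h hk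
          refine ⟨j + 1, hj, fun i hi => ?_⟩
          cases i with
          | zero => exact h'
          | succ i => exact hj' i (Nat.lt_of_succ_lt_succ hi)
  | release φ ψ ih1 ih2 =>
    have ih1 := ih1 ((code_le_pair_left _ _ _).trans hψ)
    have ih2 := ih2 ((code_le_pair_right _ _ _).trans hψ)
    have hl : ∀ w, mem w _ ↔ _ := fun w => H.loc w (.release φ ψ) hψ
    simp only [Model.Sat, ih1, ih2]
    constructor
    · intro hw
      obtain ⟨k, hk⟩ := H.done w _ hψ
      have h0 : ∀ w, (∀ k, mem ((H.model hS).S^[k] w) ψ ∨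
          ∃ i < k, mem ((H.model hS).S^[i] w) φ) → mem w ψ := fun w hw =>
        (hw 0).resolve_right fun ⟨i, hi, _⟩ => i.not_lt_zero hi
      induction k generalizing w with
      | zero => exact hk.resolve_right (not_not.2 (h0 w hw))
      | succ k ihk =>
        refine (hl w).2 ⟨h0 w hw, or_iff_not_imp_left.2 fun hφ => ihk _ (fun j => ?_) hk⟩
        refine (hw (j + 1)).imp id ?_
        rintro ⟨i, hi, h⟩
        cases i with
        | zero => exact absurd h hφ
        | succ i => exact ⟨i, Nat.lt_of_succ_lt_succ hi, h⟩
    · intro hw k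
      induction k generalizing w with
      | zero => exact Or.inl ((hl w).1 hw).1
      | succ k ihk =>
        rcases ((hl w).1 hw).2 with h | h
        · exact Or.inr ⟨0, k.succ_pos, h⟩
        · refine (ihk _ h).imp id ?_
          rintro ⟨i, hi, h⟩
          exact ⟨i + 1, Nat.succ_lt_succ hi, h⟩

end Truth

/-! ### From an arbitrary countermodel to a bounded Hintikka labelling -/

section Quotient

variable {W : Type u} [Nonempty W] [PartialOrder W] (M : Model W)

theorem Model.S_monotone : Monotone M.S := fun v w h => M.confluent v w h

theorem Model.sat_mono {w v : W} (h : w ≤ v) (ψ : Formula) (hw : M.Sat w ψ) : M.Sat v ψ := by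
  induction ψ generalizing w v with
  | var p => exact M.monotone w v h hw
  | bot => exact hw
  | and φ ψ ih1 ih2 => exact ⟨ih1 h hw.1, ih2 h hw.2⟩
  | or φ ψ ih1 ih2 => exact Or.imp (ih1 h) (ih2 h) hw
  | imp φ ψ => exact fun u hu => hw u (h.trans hu)
  | next φ ih => exact ih (M.S_monotone h) hw
  | eventually φ ih => exact hw.imp fun k hk => ih (M.S_monotone.iterate k h) hk
  | henceforth φ ih => exact fun k => ih (M.S_monotone.iterate k h) (hw k)
  | untl φ ψ ih1 ih2 =>
    exact hw.imp fun k hk => ⟨ih2 (M.S_monotone.iterate k h) hk.1,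
      fun i hi => ih1 (M.S_monotone.iterate i h) (hk.2 i hi)⟩
  | release φ ψ ih1 ih2 =>
    exact fun k => (hw k).imp (ih2 (M.S_monotone.iterate k h))
      fun ⟨i, hi, h'⟩ => ⟨i, hi, ih1 (M.S_monotone.iterate i h) h'⟩

theorem Model.localAt_sat (w : W) (ψ : Formula) : LocalAt (· ≤ ·) M.S M.Sat w ψ := by
  cases ψ with
  | var => trivial
  | and | or | imp | next => exact Iff.rfl
  | bot => exact id
  | eventually φ =>
    constructor
    · rintro ⟨_ | k, hk⟩
      · exact Or.inl hk
      · exact Or.inr ⟨k, hk⟩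
    · rintro (h | ⟨k, hk⟩)
      · exact ⟨0, h⟩
      · exact ⟨k + 1, hk⟩
  | henceforth φ =>
    constructor
    · exact fun h => ⟨h 0, fun k => h (k + 1)⟩
    · rintro ⟨h, h'⟩ (_ | k)
      · exact h
      · exact h' k
  | untl φ ψ =>
    constructor
    · rintro ⟨_ | k, hk, hk'⟩
      · exact Or.inl hk
      · exact Or.inr ⟨hk' 0 k.succ_pos, k, hk, fun i hi => hk' (i + 1) (Nat.succ_lt_succ hi)⟩
    · rintro (h | ⟨h, k, hk, hk'⟩)
      · exact ⟨0, h, fun i hi => absurd hi i.not_lt_zero⟩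
      · refine ⟨k + 1, hk, fun i hi => ?_⟩
        cases i with
        | zero => exact h
        | succ i => exact hk' i (Nat.lt_of_succ_lt_succ hi)
  | release φ ψ =>
    constructor
    · intro h
      refine ⟨(h 0).resolve_right fun ⟨i, hi, _⟩ => i.not_lt_zero hi,
        or_iff_not_imp_left.2 fun hφ k => (h (k + 1)).imp id ?_⟩
      rintro ⟨_ | i, hi, h'⟩
      · exact absurd h' hφ
      · exact ⟨i, Nat.lt_of_succ_lt_succ hi, h'⟩
    · rintro ⟨h, h'⟩ (_ | k)
      · exact Or.inl h
      · rcases h' with h' | h'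
        · exact Or.inr ⟨0, k.succ_pos, h'⟩
        · refine (h' k).imp id ?_
          rintro ⟨i, hi, h⟩
          exact ⟨i + 1, Nat.succ_lt_succ hi, h⟩

/-- If `◇φ` were never done, it would hold now while `φ` never does; if `□φ` were never done, it
would fail now while `φ` always holds. `U` and `R` are alike. -/
theorem Model.exists_done (v : W) (ψ : Formula) : ∃ k, Done (M.Sat (M.S^[k] v)) ψ := by
  by_contra! h
  cases ψ with
  | var | bot | and | or | imp | next => exact h 0 trivial
  | eventually φ =>
    simp only [Done, not_or, not_not] at h
    obtain ⟨k, hk⟩ := (h 0).2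
    exact (h k).1 hk
  | henceforth φ =>
    simp only [Done, not_or, not_not] at h
    exact (h 0).1 fun k => (h k).2
  | untl φ ψ =>
    simp only [Done, not_or, not_not] at h
    obtain ⟨k, hk, -⟩ := (h 0).2
    exact (h k).1 hk
  | release φ ψ =>
    simp only [Done, not_or, not_not] at h
    exact (h 0).1 fun k => Or.inl (h k).2

/-- Whether an eventuality is done within `k` steps is determined by truth at the present state and
membership in some upper set. -/
theorem Model.exists_upperSet_done (ψ : Formula) (k : ℕ) :
    ∃ U : Set W, IsUpperSet U ∧ ∀ v v', (M.Sat v ψ ↔ M.Sat v' ψ) → (v ∈ U ↔ v' ∈ U) →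
      (∃ j ≤ k, Done (M.Sat (M.S^[j] v)) ψ) → ∃ j ≤ k, Done (M.Sat (M.S^[j] v')) ψ := by
  -- Given the present truth value of `ψ`, either time `0` will do, or being done by time `k` means
  -- that the target occurs by then (`◇`, `U`) or fails at some time by then (`□`, `R`). The first
  -- condition is an upper set, the second the complement of one.
  have hex : ∀ χ, IsUpperSet {v | ∃ j ≤ k, M.Sat (M.S^[j] v) χ} := fun χ v v' h ⟨j, hj, hs⟩ =>
    ⟨j, hj, M.sat_mono (M.S_monotone.iterate j h) χ hs⟩
  have hall : ∀ χ, IsUpperSet {v | ∀ j ≤ k, M.Sat (M.S^[j] v) χ} := fun χ v v' h hs j hj =>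
    M.sat_mono (M.S_monotone.iterate j h) χ (hs j hj)
  have hadd : ∀ {i j : ℕ} (v : W), M.S^[i] (M.S^[j] v) = M.S^[i + j] v := fun v =>
    (Function.iterate_add_apply _ _ _ v).symm
  cases ψ with
  | var | bot | and | or | imp | next =>
    exact ⟨∅, isUpperSet_empty, fun _ _ _ _ _ => ⟨0, k.zero_le, trivial⟩⟩
  | eventually φ =>
    refine ⟨_, hex φ, fun v v' h hUv => ?_⟩
    rintro ⟨j, hj, hd⟩
    by_cases hv : M.Sat v (.eventually φ)
    · have hvU : ∃ j ≤ k, M.Sat (M.S^[j] v) φ := by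
        rcases hd with hd | hd
        · exact ⟨j, hj, hd⟩
        · obtain ⟨i, hi⟩ := hv
          refine ⟨i, ?_, hi⟩
          -- A witness later than `k`, hence later than `j`, would keep `◇φ` true at time `j`.
          by_contra hik
          exact hd ⟨i - j, by rwa [hadd, Nat.sub_add_cancel (by omega)]⟩
      obtain ⟨i, hi, hs⟩ := hUv.1 hvU
      exact ⟨i, hi, Or.inl hs⟩
    · exact ⟨0, k.zero_le, Or.inr fun h' => hv (h.2 h')⟩
  | henceforth φ =>
    refine ⟨_, hall φ, fun v v' h hUv => ?_⟩
    rintro ⟨j, hj, hd⟩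
    by_cases hv : M.Sat v (.henceforth φ)
    · exact ⟨0, k.zero_le, Or.inl (h.1 hv)⟩
    · have hvU : ¬ ∀ j ≤ k, M.Sat (M.S^[j] v) φ := by
        intro hall
        refine hv fun i => ?_
        by_cases hi : i ≤ k
        · exact hall i hi
        · have h2 := hd.resolve_right (not_not.2 (hall j hj)) (i - j)
          rwa [hadd, Nat.sub_add_cancel (by omega)] at h2
      have hvU' : ¬ ∀ j ≤ k, M.Sat (M.S^[j] v') φ := fun h' => hvU (hUv.2 h')
      simp only [not_forall] at hvU'
      obtain ⟨i, hi, hs⟩ := hvU'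
      exact ⟨i, hi, Or.inr hs⟩
  | untl φ ψ =>
    refine ⟨_, hex ψ, fun v v' h hUv => ?_⟩
    rintro ⟨j, hj, hd⟩
    by_cases hv : M.Sat v (.untl φ ψ)
    · have hvU : ∃ j ≤ k, M.Sat (M.S^[j] v) ψ := by
        rcases hd with hd | hd
        · exact ⟨j, hj, hd⟩
        · obtain ⟨i, hi, hi'⟩ := hv
          refine ⟨i, ?_, hi⟩
          by_contra hik
          exact hd ⟨i - j, by rwa [hadd, Nat.sub_add_cancel (by omega)], fun l hl => by
            rw [hadd]
            exact hi' _ (by omega)⟩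
      obtain ⟨i, hi, hs⟩ := hUv.1 hvU
      exact ⟨i, hi, Or.inl hs⟩
    · exact ⟨0, k.zero_le, Or.inr fun h' => hv (h.2 h')⟩
  | release φ ψ =>
    refine ⟨_, hall ψ, fun v v' h hUv => ?_⟩
    rintro ⟨j, hj, hd⟩
    by_cases hv : M.Sat v (.release φ ψ)
    · exact ⟨0, k.zero_le, Or.inl (h.1 hv)⟩
    · have hvU : ¬ ∀ j ≤ k, M.Sat (M.S^[j] v) ψ := by
        intro hall
        refine hv fun i => ?_
        by_cases hi : i ≤ k
        · exact Or.inl (hall i hi)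
        · have h2 := hd.resolve_right (not_not.2 (hall j hj)) (i - j)
          rw [hadd, Nat.sub_add_cancel (by omega)] at h2
          refine h2.imp id ?_
          rintro ⟨l, hl, hs⟩
          rw [hadd] at hs
          exact ⟨l + j, by omega, hs⟩
      have hvU' : ¬ ∀ j ≤ k, M.Sat (M.S^[j] v') ψ := fun h' => hvU (hUv.2 h')
      simp only [not_forall] at hvU'
      obtain ⟨i, hi, hs⟩ := hvU'
      exact ⟨i, hi, Or.inr hs⟩

/-- Membership of a formula in a set of codes. -/
def Holds {n : ℕ} (l : Set (Fin (n + 1))) (ψ : Formula) : Prop :=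
  ∃ h : ψ.code < n + 1, (⟨ψ.code, h⟩ : Fin (n + 1)) ∈ l

/-- The codes of the formulas that are true at a state. -/
def Model.label (n : ℕ) (v : W) : Set (Fin (n + 1)) := {i | M.Sat v (ofCode i)}

theorem Model.holds_label {n : ℕ} {ψ : Formula} (h : ψ.code ≤ n) (v : W) :
    Holds (M.label n v) ψ ↔ M.Sat v ψ := by
  unfold Holds Model.label
  simp only [Set.mem_ofPred_eq, ofCode_code, Nat.lt_succ_of_le h, exists_true_left]

theorem Model.label_mono (n : ℕ) : Monotone (M.label n) := fun _ _ h _ hi => M.sat_mono h _ hi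

/-- The finite set that bounds the size of countermodels. -/
abbrev Universe (n : ℕ) : Type :=
  Config (Ty (Set (Fin (n + 1)) × Prop) (n + 1 + 1)) (Set (Fin (n + 1))) (Fin (n + 1)) (n + 1 + 1) ×
    Node (Ty (Set (Fin (n + 1)) × Prop) (n + 1 + 1)) (n + 1 + 1)

theorem Model.exists_hintikka {φ : Formula} {w : W} (hw : ¬ M.Sat w φ) :
    ∃ (W' : Type) (_ : PartialOrder W') (S : W' → W') (mem : W' → Formula → Prop) (w' : W'),
      (∃ i : W' → Universe φ.code, Function.Injective i) ∧ Monotone S ∧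
      Hintikka φ.code (· ≤ ·) S mem ∧ ¬ mem w' φ := by
  set n := φ.code with hn
  -- The rank counts the formulas missing from a label. It is at most `n + 1`, and the flag adds
  -- one: hence the depth in `Universe`.
  have hrank : StrictAnti fun l : Set (Fin (n + 1)) => n + 1 - l.ncard := by
    intro a b h
    have h1 := Set.ncard_lt_ncard h b.toFinite
    have h2 := Set.ncard_le_card b
    rw [Nat.card_fin] at h2
    change n + 1 - b.ncard < n + 1 - a.ncard
    omega
  have hcong : ∀ {ψ : Formula} (v : W), ψ.code ≤ n →
      (Done (Holds (M.label n v)) ψ ↔ Done (M.Sat v) ψ) := fun v h =>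
    done_congr fun χ hχ => M.holds_label (hχ.trans h) v
  have hcode : ∀ e : Fin (n + 1), (ofCode e).code ≤ n := fun e => by
    rw [code_ofCode]
    exact Nat.le_of_lt_succ e.2
  obtain ⟨W', po, S', lab', w', hi, hS', hlab', hw', hloc, hdone⟩ :=
    exists_finite_quotient (lab := M.label n) (S := M.S) (E := Fin (n + 1))
      (don := fun e l => Done (Holds l) (ofCode e)) (M.label_mono n) M.S_monotone hrank
      (fun l => Nat.sub_le _ _) (fun e v => by
        obtain ⟨k, hk⟩ := M.exists_done v (ofCode e)
        exact ⟨k, (hcong _ (hcode e)).2 hk⟩) (fun e k => by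
        obtain ⟨U, hU, hd⟩ := M.exists_upperSet_done (ofCode e) k
        refine ⟨U, hU, fun v v' h => ?_⟩
        simp only [hcong _ (hcode e)]
        exact hd v v' (Set.ext_iff.1 h e)) w
  refine ⟨W', po, S', fun y => Holds (lab' y), w', hi, hS', ⟨?_, ?_, ?_⟩, ?_⟩
  · rintro y z ψ - hyz ⟨h, h'⟩
    exact ⟨h, hlab' hyz h'⟩
  · intro y ψ hψ
    obtain ⟨v, h1, h2, h3⟩ := hloc y
    have hv : ∀ χ : Formula, χ.code ≤ n → (Holds (lab' y) χ ↔ M.Sat v χ) := fun χ hχ => by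
      rw [h1, M.holds_label hχ]
    have hv' : ∀ χ : Formula, χ.code ≤ n → (Holds (lab' (S' y)) χ ↔ M.Sat (M.S v) χ) :=
      fun χ hχ => by rw [h2, M.holds_label hχ]
    have hl := M.localAt_sat v ψ
    cases ψ with
    | var => trivial
    | bot => exact fun h => hl ((hv _ hψ).1 h)
    | and φ ψ | or φ ψ | untl φ ψ | release φ ψ =>
      have e1 := hv φ ((code_le_pair_left _ _ _).trans hψ)
      have e2 := hv ψ ((code_le_pair_right _ _ _).trans hψ)
      have e3 := hv _ hψ
      have e4 := hv' _ hψ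
      simp only [LocalAt, e1, e2, e3, e4] at hl ⊢
      exact hl
    | next φ | eventually φ | henceforth φ =>
      have hφ : φ.code ≤ n := by simp only [code] at hψ; omega
      have e1 := hv φ hφ
      have e2 := hv' φ hφ
      have e3 := hv _ hψ
      have e4 := hv' _ hψ
      simp only [LocalAt, e1, e2, e3, e4] at hl ⊢
      exact hl
    | imp φ ψ =>
      have c1 := (code_le_pair_left _ _ _).trans hψ
      have c2 := (code_le_pair_right _ _ _).trans hψ
      change Holds (lab' y) _ ↔ ∀ z, y ≤ z → Holds (lab' z) φ → Holds (lab' z) ψ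
      constructor
      · rintro ⟨h, h'⟩ z hyz hz
        -- The point `u` realizing `z` need not lie above `v`. The implication is therefore carried
        -- up to `z` by monotonicity of labels and applied at `u` itself.
        obtain ⟨u, hu, -⟩ := hloc z
        have h4 : Holds (lab' z) (.imp φ ψ) := ⟨h, hlab' hyz h'⟩
        rw [hu, M.holds_label hψ] at h4
        rw [hu, M.holds_label c1] at hz
        rw [hu, M.holds_label c2]
        exact h4 u le_rfl hz
      · intro h
        rw [hv _ hψ]
        intro u hu hφ
        obtain ⟨z, hyz, hz⟩ := h3 u hu
        have h4 := h z hyz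
        rw [hz, M.holds_label c1, M.holds_label c2] at h4
        exact h4 hφ
  · intro y ψ hψ
    obtain ⟨k, hk⟩ := hdone ⟨ψ.code, Nat.lt_succ_of_le hψ⟩ y
    simp only [ofCode_code] at hk
    exact ⟨k, hk⟩
  · beta_reduce
    rw [hw', M.holds_label le_rfl]
    exact hw

end Quotient

/-! ### A primitive recursive size bound -/

section Card

/-- The number of types of depth `d` over `l` labels. -/
def tyCard (l d : ℕ) : ℕ := Nat.rec l (fun _ c => l * 2 ^ c) d

theorem card_set_eq (α : Type) [Finite α] : Nat.card (Set α) = 2 ^ Nat.card α := by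
  have : Fintype α := Fintype.ofFinite _
  rw [Nat.card_eq_fintype_card, Nat.card_eq_fintype_card, Fintype.card_set]

theorem card_ty (L : Type) [Finite L] (d : ℕ) : Nat.card (Ty L d) = tyCard (Nat.card L) d := by
  induction d with
  | zero => rfl
  | succ d ih =>
    change Nat.card (L × Set (Ty L d)) = _
    rw [Nat.card_prod, card_set_eq, ih]
    rfl

theorem node_injective (X : Type) (D : ℕ) :
    Function.Injective fun (l : Node X D) (i : Fin D) => l.1[i.1]? := by
  intro l l' h
  refine Subtype.ext (List.ext_getElem? fun i => ?_)
  by_cases hi : i < D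
  · exact congrFun h ⟨i, hi⟩
  · rw [List.getElem?_eq_none (by have := l.2; omega),
      List.getElem?_eq_none (by have := l'.2; omega)]

instance (X : Type) [Finite X] (D : ℕ) : Finite (Node X D) :=
  Finite.of_injective _ (node_injective X D)

theorem card_node_le (X : Type) [Finite X] (D : ℕ) :
    Nat.card (Node X D) ≤ (Nat.card X + 1) ^ D := by
  refine (Nat.card_le_card_of_injective _ (node_injective X D)).trans_eq ?_
  rw [Nat.card_fun, Finite.card_option, Nat.card_fin]

/-- A bound for the number of nodes of labelled trees. -/
def nodeBound (n : ℕ) : ℕ := (tyCard (2 ^ (n + 1) * 2) (n + 2) + 1) ^ (n + 2)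

/-- A bound for the size of countermodels. -/
def sizeBound (n : ℕ) : ℕ :=
  2 ^ nodeBound n * (2 ^ (n + 1)) ^ nodeBound n * 2 ^ (nodeBound n * (n + 1)) * nodeBound n

theorem card_universe_le (n : ℕ) : Nat.card (Universe n) ≤ sizeBound n := by
  have hN : Nat.card (Node (Ty (Set (Fin (n + 1)) × Prop) (n + 2)) (n + 2)) ≤ nodeBound n := by
    refine (card_node_le _ _).trans_eq ?_
    rw [card_ty, Nat.card_prod, card_set_eq, Nat.card_fin,
      show Nat.card Prop = 2 by rw [Nat.card_eq_fintype_card, Fintype.card_prop]]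
    rfl
  unfold sizeBound
  simp only [Nat.card_prod, Nat.card_fun, card_set_eq, Nat.card_fin]
  gcongr <;> first | exact hN | exact Nat.one_le_two_pow | norm_num

theorem primrec_tyCard : Primrec₂ tyCard := by
  refine Primrec.nat_rec (f := fun l : ℕ => l) (g := fun l p => l * 2 ^ p.2) Primrec.id ?_
  exact Primrec.nat_mul.comp Primrec.fst
    (Primrec₂.unpaired'.1 Nat.Primrec.pow |>.comp (Primrec.const 2)
      (Primrec.snd.comp Primrec.snd))

theorem primrec_pow : Primrec₂ ((· ^ ·) : ℕ → ℕ → ℕ) := Primrec₂.unpaired'.1 Nat.Primrec.pow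

theorem primrec_nodeBound : Primrec nodeBound := by
  have h1 : Primrec fun n : ℕ => n + 1 := Primrec.succ
  have h2 : Primrec fun n : ℕ => n + 2 := Primrec.succ.comp Primrec.succ
  exact primrec_pow.comp (Primrec.succ.comp (primrec_tyCard.comp
    (Primrec.nat_mul.comp (primrec_pow.comp (Primrec.const 2) h1) (Primrec.const 2)) h2)) h2

theorem primrec_sizeBound : Primrec sizeBound := by
  have h1 : Primrec fun n : ℕ => n + 1 := Primrec.succ
  have h2 := primrec_nodeBound
  have h3 := primrec_pow.comp (Primrec.const 2) h2
  exact Primrec.nat_mul.comp (Primrec.nat_mul.comp (Primrec.nat_mul.comp h3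
    (primrec_pow.comp (primrec_pow.comp (Primrec.const 2) h1) h2))
    (primrec_pow.comp (Primrec.const 2) (Primrec.nat_mul.comp h2 h1))) h2

end Card

/-! ### Arithmetical coding of finite labelled models -/

section Coding

/-- The digit at position `i` of `c` in base `b`. -/
def dig (b c i : ℕ) : ℕ := c / b ^ i % b

theorem exists_dig {b : ℕ} (f : ℕ → ℕ) :
    ∀ k, (∀ i < k, f i < b) → ∃ c < b ^ k, ∀ i < k, dig b c i = f i
  | 0, _ => ⟨0, by simp, fun i hi => absurd hi i.not_lt_zero⟩
  | k + 1, hf => by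
    obtain ⟨c, hc, h⟩ := exists_dig f k fun i hi => hf i (by omega)
    have hk := hf k (by omega)
    have hb : 0 < b := by omega
    refine ⟨c + b ^ k * f k, ?_, fun i hi => ?_⟩
    · calc c + b ^ k * f k < b ^ k + b ^ k * f k := by omega
        _ = b ^ k * (f k + 1) := by ring
        _ ≤ b ^ k * b := Nat.mul_le_mul_left _ hk
        _ = b ^ (k + 1) := (pow_succ _ _).symm
    · rcases Nat.lt_succ_iff_lt_or_eq.1 hi with hi | rfl
      · rw [← h i hi]
        obtain ⟨d, rfl⟩ := Nat.exists_eq_add_of_lt hi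
        have : c + b ^ (i + d + 1) * f (i + d + 1) =
            c + b ^ i * (b * (b ^ d * f (i + d + 1))) := by ring
        rw [dig, dig, this, Nat.add_mul_div_left _ _ (pow_pos hb i), Nat.add_mul_mod_self_left]
      · rw [dig, Nat.add_mul_div_left _ _ (pow_pos hb i), Nat.div_eq_of_lt hc, zero_add,
          Nat.mod_eq_of_lt hk]

theorem exists_dig_two (k l : ℕ) (P : ℕ → ℕ → Prop) :
    ∃ c < 2 ^ (k * l), ∀ i < k, ∀ j < l, (dig 2 c (i * l + j) = 1 ↔ P i j) := by
  classical
  -- The relation is stored as a table row by row, so quotient and remainder by `l` recover the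
  -- indices.
  obtain ⟨c, hc, h⟩ := exists_dig (b := 2) (fun x => if P (x / l) (x % l) then 1 else 0) (k * l)
    (fun i _ => by split_ifs <;> omega)
  refine ⟨c, hc, fun i hi j hj => ?_⟩
  have h1 : i * l + j < k * l := by
    calc i * l + j < i * l + l := by omega
      _ = (i + 1) * l := by ring
      _ ≤ k * l := Nat.mul_le_mul_right _ hi
  rw [h _ h1, mul_comm i l, Nat.mul_add_div (by omega), Nat.mul_add_mod, Nat.div_eq_of_lt hj,
    Nat.mod_eq_of_lt hj, add_zero]
  split_ifs with hP <;> simp [hP]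

/-- The local conditions for the formula of code `k`, over the states `0, …, m - 1`. -/
def LocalCode (m : ℕ) (le : ℕ → ℕ → Prop) (S : ℕ → ℕ) (mem : ℕ → ℕ → Prop) (i k : ℕ) : Prop :=
  (k = 0 → ¬ mem i k) ∧
  ((k - 1) % 9 = 1 → (mem i k ↔ mem i ((k - 1) / 9).unpair.1 ∧ mem i ((k - 1) / 9).unpair.2)) ∧
  ((k - 1) % 9 = 2 → (mem i k ↔ mem i ((k - 1) / 9).unpair.1 ∨ mem i ((k - 1) / 9).unpair.2)) ∧
  ((k - 1) % 9 = 3 → (mem i k ↔ ∀ j < m, le i j →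
    mem j ((k - 1) / 9).unpair.1 → mem j ((k - 1) / 9).unpair.2)) ∧
  ((k - 1) % 9 = 4 → (mem i k ↔ mem i ((k - 1) / 9).unpair.2 ∨
    mem i ((k - 1) / 9).unpair.1 ∧ mem (S i) k)) ∧
  ((k - 1) % 9 = 5 → (mem i k ↔ mem i ((k - 1) / 9).unpair.2 ∧
    (mem i ((k - 1) / 9).unpair.1 ∨ mem (S i) k))) ∧
  ((k - 1) % 9 = 6 → (mem i k ↔ mem (S i) ((k - 1) / 9))) ∧
  ((k - 1) % 9 = 7 → (mem i k ↔ mem i ((k - 1) / 9) ∨ mem (S i) k)) ∧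
  ((k - 1) % 9 = 8 → (mem i k ↔ mem i ((k - 1) / 9) ∧ mem (S i) k))

/-- The eventuality expressed by the formula of code `k`, if any, is fulfilled or void. -/
def DoneCode (mem : ℕ → Prop) (k : ℕ) : Prop :=
  ((k - 1) % 9 = 4 → mem ((k - 1) / 9).unpair.2 ∨ ¬ mem k) ∧
  ((k - 1) % 9 = 5 → mem k ∨ ¬ mem ((k - 1) / 9).unpair.2) ∧
  ((k - 1) % 9 = 7 → mem ((k - 1) / 9) ∨ ¬ mem k) ∧
  ((k - 1) % 9 = 8 → mem k ∨ ¬ mem ((k - 1) / 9))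

/-- For a nonzero code `k`, the residue of `k - 1` modulo 9 names the main connective. Code `0` of
`⊥` truncates to residue `0`, shared with the variables, for which no other clause fires. -/
theorem localCode_code {m : ℕ} {le : ℕ → ℕ → Prop} {S : ℕ → ℕ} {mem : ℕ → ℕ → Prop} {i : ℕ}
    (ψ : Formula) : LocalCode m le S mem i ψ.code ↔
      LocalAt (fun i j => j < m ∧ le i j) S (fun i χ => mem i χ.code) i ψ := by
  have hd : ∀ x r : ℕ, r < 9 → (9 * x + (r + 1) - 1) / 9 = x := by intro m r hr; omega
  have hm : ∀ x r : ℕ, r < 9 → (9 * x + (r + 1) - 1) % 9 = r := by intro m r hr; omega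
  have h0 : ∀ x r : ℕ, 9 * x + (r + 1) ≠ 0 := by intro x r; omega
  cases ψ with
  | bot => simp [LocalCode, LocalAt, code]
  | var p => simp [LocalCode, LocalAt, code]
  | and φ ψ =>
    have := hd (Nat.pair φ.code ψ.code) 1 (by norm_num)
    have := hm (Nat.pair φ.code ψ.code) 1 (by norm_num)
    simp_all [LocalCode, LocalAt, code]
  | or φ ψ =>
    have := hd (Nat.pair φ.code ψ.code) 2 (by norm_num)
    have := hm (Nat.pair φ.code ψ.code) 2 (by norm_num)
    simp_all [LocalCode, LocalAt, code]
  | imp φ ψ =>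
    have := hd (Nat.pair φ.code ψ.code) 3 (by norm_num)
    have := hm (Nat.pair φ.code ψ.code) 3 (by norm_num)
    simp_all [LocalCode, LocalAt, code]
  | untl φ ψ =>
    have := hd (Nat.pair φ.code ψ.code) 4 (by norm_num)
    have := hm (Nat.pair φ.code ψ.code) 4 (by norm_num)
    simp_all [LocalCode, LocalAt, code]
  | release φ ψ =>
    have := hd (Nat.pair φ.code ψ.code) 5 (by norm_num)
    have := hm (Nat.pair φ.code ψ.code) 5 (by norm_num)
    simp_all [LocalCode, LocalAt, code]
  | next φ =>
    have := hd φ.code 6 (by norm_num)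
    have := hm φ.code 6 (by norm_num)
    simp_all [LocalCode, LocalAt, code]
  | eventually φ =>
    have := hd φ.code 7 (by norm_num)
    have := hm φ.code 7 (by norm_num)
    simp_all [LocalCode, LocalAt, code]
  | henceforth φ =>
    have := hd φ.code 8 (by norm_num)
    have := hm φ.code 8 (by norm_num)
    simp_all [LocalCode, LocalAt, code]

theorem doneCode_code {mem : ℕ → Prop} (ψ : Formula) :
    DoneCode mem ψ.code ↔ Done (fun χ => mem χ.code) ψ := by
  have hd : ∀ x r : ℕ, r < 9 → (9 * x + (r + 1) - 1) / 9 = x := by intro m r hr; omega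
  have hm : ∀ x r : ℕ, r < 9 → (9 * x + (r + 1) - 1) % 9 = r := by intro m r hr; omega
  cases ψ with
  | bot => simp [DoneCode, Done, code]
  | var p => simp [DoneCode, Done, code]
  | and φ ψ =>
    have := hm (Nat.pair φ.code ψ.code) 1 (by norm_num)
    simp_all [DoneCode, Done, code]
  | or φ ψ =>
    have := hm (Nat.pair φ.code ψ.code) 2 (by norm_num)
    simp_all [DoneCode, Done, code]
  | imp φ ψ =>
    have := hm (Nat.pair φ.code ψ.code) 3 (by norm_num)
    simp_all [DoneCode, Done, code]
  | untl φ ψ =>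
    have := hd (Nat.pair φ.code ψ.code) 4 (by norm_num)
    have := hm (Nat.pair φ.code ψ.code) 4 (by norm_num)
    simp_all [DoneCode, Done, code]
  | release φ ψ =>
    have := hd (Nat.pair φ.code ψ.code) 5 (by norm_num)
    have := hm (Nat.pair φ.code ψ.code) 5 (by norm_num)
    simp_all [DoneCode, Done, code]
  | next φ =>
    have := hm φ.code 6 (by norm_num)
    simp_all [DoneCode, Done, code]
  | eventually φ =>
    have := hd φ.code 7 (by norm_num)
    have := hm φ.code 7 (by norm_num)
    simp_all [DoneCode, Done, code]
  | henceforth φ =>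
    have := hd φ.code 8 (by norm_num)
    have := hm φ.code 8 (by norm_num)
    simp_all [DoneCode, Done, code]

/-- The numbers `a`, `b`, `c` code a countermodel to the formula of code `n` with the states
`0, …, m - 1`: the order, the transition function and the formulas that hold at each state. -/
def IsCountermodel (n m a b c : ℕ) : Prop :=
  (∀ i < m, dig 2 a (i * m + i) = 1) ∧
  (∀ i < m, ∀ j < m, ∀ k < m, dig 2 a (i * m + j) = 1 → dig 2 a (j * m + k) = 1 →
    dig 2 a (i * m + k) = 1) ∧
  (∀ i < m, ∀ j < m, dig 2 a (i * m + j) = 1 → dig 2 a (j * m + i) = 1 → i = j) ∧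
  (∀ i < m, ∀ j < m, dig 2 a (i * m + j) = 1 → dig 2 a (dig m b i * m + dig m b j) = 1) ∧
  (∀ i < m, ∀ j < m, ∀ k < n + 1, dig 2 a (i * m + j) = 1 → dig 2 c (i * (n + 1) + k) = 1 →
    dig 2 c (j * (n + 1) + k) = 1) ∧
  (∀ i < m, ∀ k < n + 1, LocalCode m (fun i j => dig 2 a (i * m + j) = 1) (dig m b)
    (fun i k => dig 2 c (i * (n + 1) + k) = 1) i k) ∧
  (∀ i < m, ∀ k < n + 1, ∃ t < m,
    DoneCode (fun k => dig 2 c ((dig m b)^[t] i * (n + 1) + k) = 1) k) ∧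
  ∃ i < m, ¬ dig 2 c (i * (n + 1) + n) = 1

end Coding

/-! ### Primitive recursiveness of the countermodel check -/

section Primrec

variable {α : Type} [Primcodable α]

theorem primrecPred_imp {p q : α → Prop} (hp : PrimrecPred p) (hq : PrimrecPred q) :
    PrimrecPred fun a => p a → q a :=
  (hp.not.or hq).of_eq fun _ => imp_iff_not_or.symm

theorem primrecPred_iff {p q : α → Prop} (hp : PrimrecPred p) (hq : PrimrecPred q) :
    PrimrecPred fun a => p a ↔ q a :=
  ((primrecPred_imp hp hq).and (primrecPred_imp hq hp)).of_eq fun _ => iff_iff_implies_and_implies.symm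

theorem primrecPred_forall_lt {f : α → ℕ} {p : α → ℕ → Prop} (hf : Primrec f)
    (hp : PrimrecPred fun x : α × ℕ => p x.1 x.2) : PrimrecPred fun a => ∀ i < f a, p a i :=
  ((PrimrecRel.forall_mem_list (R := fun i a => p a i)
    (hp.comp (Primrec.pair Primrec.snd Primrec.fst))).comp (Primrec.list_range.comp hf)
    Primrec.id).of_eq fun a => by simp

theorem primrecPred_exists_lt {f : α → ℕ} {p : α → ℕ → Prop} (hf : Primrec f)
    (hp : PrimrecPred fun x : α × ℕ => p x.1 x.2) : PrimrecPred fun a => ∃ i < f a, p a i :=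
  ((PrimrecRel.exists_mem_list (R := fun i a => p a i)
    (hp.comp (Primrec.pair Primrec.snd Primrec.fst))).comp (Primrec.list_range.comp hf)
    Primrec.id).of_eq fun a => by simp

theorem primrecPred_eq {f g : α → ℕ} (hf : Primrec f) (hg : Primrec g) :
    PrimrecPred fun a => f a = g a :=
  Primrec.eq.comp hf hg

theorem primrec_dig {f g h : α → ℕ} (hf : Primrec f) (hg : Primrec g) (hh : Primrec h) :
    Primrec fun a => dig (f a) (g a) (h a) :=
  Primrec.nat_mod.comp (Primrec.nat_div.comp hg (primrec_pow.comp hf hh)) hf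

theorem primrec_iterate {f g : α → ℕ} {h : α → ℕ → ℕ} (hf : Primrec f) (hg : Primrec g)
    (hh : Primrec fun x : α × ℕ => h x.1 x.2) : Primrec fun a => (h a)^[f a] (g a) :=
  Primrec.nat_iterate hf hg hh

theorem primrec_self : Primrec fun a : α => a := Primrec.id

theorem primrec_add {f g : α → ℕ} (hf : Primrec f) (hg : Primrec g) :
    Primrec fun a => f a + g a := Primrec.nat_add.comp hf hg

theorem primrec_mul {f g : α → ℕ} (hf : Primrec f) (hg : Primrec g) :
    Primrec fun a => f a * g a := Primrec.nat_mul.comp hf hg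

theorem primrec_unpair_fst {f : α → ℕ} (hf : Primrec f) : Primrec fun a => (f a).unpair.1 :=
  Primrec.fst.comp (Primrec.unpair.comp hf)

theorem primrec_unpair_snd {f : α → ℕ} (hf : Primrec f) : Primrec fun a => (f a).unpair.2 :=
  Primrec.snd.comp (Primrec.unpair.comp hf)

theorem primrec_sub_one_div {f : α → ℕ} (hf : Primrec f) : Primrec fun a => (f a - 1) / 9 :=
  Primrec.nat_div.comp (Primrec.nat_sub.comp hf (Primrec.const 1)) (Primrec.const 9)

theorem primrec_sub_one_mod {f : α → ℕ} (hf : Primrec f) : Primrec fun a => (f a - 1) % 9 :=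
  Primrec.nat_mod.comp (Primrec.nat_sub.comp hf (Primrec.const 1)) (Primrec.const 9)

theorem primrecPred_isCountermodel : PrimrecPred fun x : (((ℕ × ℕ) × ℕ) × ℕ) × ℕ =>
    IsCountermodel x.1.1.1.1 x.1.1.1.2 x.1.1.2 x.1.2 x.2 := by
  -- All quantifiers are bounded, including the time `t < m` for eventualities, so closure
  -- properties suffice.
  unfold IsCountermodel LocalCode DoneCode
  repeat' first
    | with_reducible exact Primrec.const _
    | with_reducible exact primrec_self
    | with_reducible apply PrimrecPred.and
    | with_reducible apply primrecPred_forall_lt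
    | with_reducible apply primrecPred_exists_lt
    | with_reducible apply primrecPred_eq
    | with_reducible apply PrimrecPred.not
    | with_reducible apply PrimrecPred.or
    | with_reducible apply primrecPred_iff
    | with_reducible apply primrecPred_imp
    | with_reducible apply primrec_dig
    | with_reducible apply primrec_iterate
    | with_reducible apply primrec_add
    | with_reducible apply primrec_mul
    | with_reducible apply primrec_sub_one_div
    | with_reducible apply primrec_sub_one_mod
    | with_reducible apply primrec_unpair_fst
    | with_reducible apply primrec_unpair_snd
    | with_reducible apply Primrec.fst.comp
    | with_reducible apply Primrec.snd.comp

end Primrec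

/-! ### Correctness of the bounded search -/

theorem Formula.localAt_congr {A : Type*} {B : Type*} {leA : A → A → Prop} {leB : B → B → Prop}
    {SA : A → A} {SB : B → B} {memA : A → Formula → Prop} {memB : B → Formula → Prop} {a : A}
    {b : B} {ψ : Formula} (h : ∀ χ : Formula, χ.code ≤ ψ.code → (memA a χ ↔ memB b χ))
    (hS : ∀ χ : Formula, χ.code ≤ ψ.code → (memA (SA a) χ ↔ memB (SB b) χ))
    (himp : ∀ φ χ : Formula, φ.code ≤ ψ.code → χ.code ≤ ψ.code →
      ((∀ v, leA a v → memA v φ → memA v χ) ↔ ∀ v, leB b v → memB v φ → memB v χ)) :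
    LocalAt leA SA memA a ψ ↔ LocalAt leB SB memB b ψ := by
  have h0 := h _ le_rfl
  have h0' := hS _ le_rfl
  cases ψ with
  | var => exact Iff.rfl
  | bot => exact not_congr h0
  | and φ ψ | or φ ψ | untl φ ψ | release φ ψ =>
    have h1 := h φ (code_le_pair_left _ _ _)
    have h2 := h ψ (code_le_pair_right _ _ _)
    simp only [LocalAt, h0, h0', h1, h2]
  | imp φ ψ =>
    exact iff_congr h0 (himp φ ψ (code_le_pair_left _ _ _) (code_le_pair_right _ _ _))
  | next φ | eventually φ | henceforth φ =>
    have h1 := h φ (by simp only [code]; omega)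
    have h2 := hS φ (by simp only [code]; omega)
    simp only [LocalAt, h0, h0', h1, h2]

/-- The orbit cannot repeat up to the first time at which `P` holds, since cutting out the loop
would reach `P` earlier. This justifies the bound on `t` in `IsCountermodel`. -/
theorem exists_iterate_lt {W : Type*} {m : ℕ} {idx : W → ℕ} (hidx : Function.Injective idx)
    (hlt : ∀ x, idx x < m) (S : W → W) (P : W → Prop) {x : W} (h : ∃ k, P (S^[k] x)) :
    ∃ k < m, P (S^[k] x) := by
  classical
  refine ⟨Nat.find h, ?_, Nat.find_spec h⟩
  have key : ∀ i j, i < j → j ≤ Nat.find h → S^[i] x ≠ S^[j] x := by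
    intro i j hij hj he
    refine Nat.find_min h (m := Nat.find h - j + i) (by omega) ?_
    rw [Function.iterate_add_apply, he, ← Function.iterate_add_apply, Nat.sub_add_cancel hj]
    exact Nat.find_spec h
  have hinj : Function.Injective fun i : Fin (Nat.find h + 1) =>
      (⟨idx (S^[i] x), hlt _⟩ : Fin m) := by
    intro i j hij
    have hij := hidx (Fin.mk.inj hij)
    rcases lt_trichotomy i.1 j.1 with hl | hl | hl
    · exact absurd hij (key _ _ hl (Nat.le_of_lt_succ j.2))
    · exact Fin.ext hl
    · exact absurd hij.symm (key _ _ hl (Nat.le_of_lt_succ i.2))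
  have := Fintype.card_le_of_injective _ hinj
  simp only [Fintype.card_fin] at this
  omega

/-- A finite labelling that refutes `φ` is coded by numbers. -/
theorem exists_isCountermodel {W : Type} [PartialOrder W] [Finite W] {φ : Formula} {S : W → W}
    {mem : W → Formula → Prop} (hS : Monotone S) (H : Hintikka φ.code (· ≤ ·) S mem) {w : W}
    (hw : ¬ mem w φ) :
    ∃ a < 2 ^ (Nat.card W * Nat.card W), ∃ b < Nat.card W ^ Nat.card W,
      ∃ c < 2 ^ (Nat.card W * (φ.code + 1)), IsCountermodel φ.code (Nat.card W) a b c := by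
  classical
  set m := Nat.card W with hm
  set n := φ.code with hn
  let e : W ≃ Fin m := Finite.equivFin W
  let st : ℕ → W := fun i => if h : i < m then e.symm ⟨i, h⟩ else w
  let idx : W → ℕ := fun x => (e x).1
  have hidx : ∀ x, idx x < m := fun x => (e x).2
  have hst : ∀ x, st (idx x) = x := fun x => by
    change dite _ _ _ = _
    rw [dif_pos (hidx x)]
    exact e.symm_apply_apply x
  have hidx_st : ∀ i < m, idx (st i) = i := fun i hi => by
    change (e (dite _ _ _)).1 = _
    rw [dif_pos hi, Equiv.apply_symm_apply]
  obtain ⟨a, ha, hle⟩ := exists_dig_two m m fun i j => st i ≤ st j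
  obtain ⟨b, hb, hdig⟩ := exists_dig (b := m) (fun i => idx (S (st i))) m fun i _ => hidx _
  obtain ⟨c, hc, hmem⟩ := exists_dig_two m (n + 1) fun i k => mem (st i) (ofCode k)
  have hb_lt : ∀ i < m, dig m b i < m := fun i hi => by rw [hdig i hi]; exact hidx _
  have hst_b : ∀ i < m, st (dig m b i) = S (st i) := fun i hi => by rw [hdig i hi, hst]
  have hmem' : ∀ i < m, ∀ ψ : Formula, ψ.code ≤ n →
      (dig 2 c (i * (n + 1) + ψ.code) = 1 ↔ mem (st i) ψ) := fun i hi ψ hψ => by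
    rw [hmem i hi _ (Nat.lt_succ_of_le hψ), ofCode_code]
  have hiter : ∀ t, ∀ i < m, (dig m b)^[t] i < m ∧ st ((dig m b)^[t] i) = S^[t] (st i) := by
    intro t
    induction t with
    | zero => exact fun i hi => ⟨hi, rfl⟩
    | succ t ih =>
      intro i hi
      have := ih _ (hb_lt i hi)
      rw [hst_b i hi] at this
      exact this
  refine ⟨a, ha, b, hb, c, hc, ?_, ?_, ?_, ?_, ?_, ?_, ?_, ?_⟩
  · exact fun i hi => (hle i hi i hi).2 le_rfl
  · intro i hi j hj k hk h1 h2
    exact (hle i hi k hk).2 (((hle i hi j hj).1 h1).trans ((hle j hj k hk).1 h2))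
  · intro i hi j hj h1 h2
    rw [← hidx_st i hi, ((hle i hi j hj).1 h1).antisymm ((hle j hj i hi).1 h2), hidx_st j hj]
  · intro i hi j hj h1
    rw [hle _ (hb_lt i hi) _ (hb_lt j hj), hst_b i hi, hst_b j hj]
    exact hS ((hle i hi j hj).1 h1)
  · intro i hi j hj k hk h1 h2
    rw [hmem j hj k hk]
    exact H.mono _ _ _ (by rw [code_ofCode]; omega) ((hle i hi j hj).1 h1) ((hmem i hi k hk).1 h2)
  · intro i hi k hk
    have hk' : (ofCode k).code ≤ n := by rw [code_ofCode]; omega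
    rw [← code_ofCode k, localCode_code]
    refine (localAt_congr (fun χ hχ => hmem' i hi χ (hχ.trans hk')) (fun χ hχ => ?_)
      fun φ χ hφ hχ => ?_).2 (H.loc (st i) (ofCode k) hk')
    · rw [hmem' _ (hb_lt i hi) χ (hχ.trans hk'), hst_b i hi]
    · constructor
      · intro h v hv
        have := h (idx v) ⟨hidx v, (hle i hi _ (hidx v)).2 (by rwa [hst])⟩
        rwa [hmem' _ (hidx v) _ (hφ.trans hk'), hmem' _ (hidx v) _ (hχ.trans hk'), hst] at this
      · rintro h j ⟨hj, hij⟩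
        rw [hmem' _ hj _ (hφ.trans hk'), hmem' _ hj _ (hχ.trans hk')]
        exact h _ ((hle i hi j hj).1 hij)
  · intro i hi k hk
    have hk' : (ofCode k).code ≤ n := by rw [code_ofCode]; omega
    obtain ⟨t, ht, hd⟩ := exists_iterate_lt (idx := idx) (fun x y h => by
      rw [← hst x, ← hst y, h]) hidx S (fun x => Done (mem x) (ofCode k)) (H.done (st i) _ hk')
    refine ⟨t, ht, ?_⟩
    rw [← code_ofCode k, doneCode_code]
    refine (done_congr fun χ hχ => ?_).2 hd
    rw [hmem' _ (hiter t i hi).1 χ (hχ.trans hk'), (hiter t i hi).2]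
  · refine ⟨idx w, hidx w, fun h => hw ?_⟩
    rwa [hmem' _ (hidx w) φ le_rfl, hst] at h

/-- The states of a coded model. -/
def CodedState (m : ℕ) : Type u := ULift.{u} (Fin m)

/-- The coded model is lifted to the universe `u`, so a single arithmetical criterion serves
validity in every universe. -/
theorem IsCountermodel.not_valid {φ : Formula} {m a b c : ℕ}
    (h : IsCountermodel φ.code m a b c) : ¬ Formula.Valid.{u} φ := by
  obtain ⟨hrefl, htrans, hanti, hmono, hpers, hloc, hdone, i₀, hi₀, hw⟩ := h
  have hb_lt : ∀ i, dig m b i < m := fun i => Nat.mod_lt _ (by omega)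
  let po : PartialOrder (CodedState.{u} m) :=
    { le := fun x y => dig 2 a (x.down.1 * m + y.down.1) = 1
      le_refl := fun x => hrefl _ x.down.2
      le_trans := fun x y z => htrans _ x.down.2 _ y.down.2 _ z.down.2
      le_antisymm := fun x y hxy hyx => ULift.ext _ _ (Fin.ext
        (hanti _ x.down.2 _ y.down.2 hxy hyx)) }
  have ne : Nonempty (CodedState.{u} m) := ⟨⟨⟨i₀, hi₀⟩⟩⟩
  let S : CodedState.{u} m → CodedState.{u} m := fun x => ⟨⟨dig m b x.down.1, hb_lt _⟩⟩
  let mem : CodedState.{u} m → Formula → Prop := fun x ψ =>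
    dig 2 c (x.down.1 * (φ.code + 1) + ψ.code) = 1
  have hS : Monotone S := fun x y hxy => hmono _ x.down.2 _ y.down.2 hxy
  have hiter : ∀ t (x : CodedState.{u} m), (S^[t] x).down.1 = (dig m b)^[t] x.down.1 := by
    intro t
    induction t with
    | zero => exact fun x => rfl
    | succ t ih => exact fun x => ih (S x)
  have H : Hintikka φ.code (· ≤ ·) S mem := by
    refine ⟨fun x y ψ hψ hxy => hpers _ x.down.2 _ y.down.2 _ (Nat.lt_succ_of_le hψ) hxy,
      fun x ψ hψ => ?_, fun x ψ hψ => ?_⟩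
    · have hl := (localCode_code ψ).1 (hloc _ x.down.2 _ (Nat.lt_succ_of_le hψ))
      refine (localAt_congr (memB := mem) (fun χ _ => ?_) (fun χ _ => ?_)
        fun φ' χ _ _ => ?_).1 hl
      · exact Iff.rfl
      · exact Iff.rfl
      constructor
      · exact fun h v hv => h v.down.1 ⟨v.down.2, hv⟩
      · rintro h j ⟨hj, hij⟩
        exact h ⟨⟨j, hj⟩⟩ hij
    · obtain ⟨t, -, ht⟩ := hdone _ x.down.2 _ (Nat.lt_succ_of_le hψ)
      refine ⟨t, (done_congr fun χ _ => ?_).1 ((doneCode_code ψ).1 ht)⟩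
      change _ ↔ dig 2 c ((S^[t] x).down.1 * (φ.code + 1) + χ.code) = 1
      rw [hiter]
  exact fun hv => hw ((H.sat_iff hS φ le_rfl ⟨⟨i₀, hi₀⟩⟩).1 (hv _ (H.model hS) _))

/-- The formula of code `n` has a countermodel coded by numbers below explicit bounds. -/
def HasCountermodel (n : ℕ) : Prop :=
  ∃ m < sizeBound n + 1, ∃ a < 2 ^ (m * m), ∃ b < m ^ m, ∃ c < 2 ^ (m * (n + 1)),
    IsCountermodel n m a b c

theorem valid_iff (φ : Formula) : Formula.Valid.{u} φ ↔ ¬ HasCountermodel φ.code := by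
  constructor
  · rintro h ⟨m, -, a, -, b, -, c, -, hc⟩
    exact hc.not_valid h
  · intro h W _ _ M w
    by_contra hw
    obtain ⟨W', _, S, mem, w', ⟨i, hi⟩, hS, H, hw'⟩ := M.exists_hintikka hw
    have : Finite W' := Finite.of_injective i hi
    have hcard := (Nat.card_le_card_of_injective i hi).trans (card_universe_le _)
    exact h ⟨Nat.card W', Nat.lt_succ_of_le hcard, exists_isCountermodel hS H hw'⟩

theorem primrecPred_hasCountermodel : PrimrecPred HasCountermodel := by
  unfold HasCountermodel
  refine primrecPred_exists_lt (Primrec.succ.comp primrec_sizeBound) ?_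
  refine primrecPred_exists_lt (primrec_pow.comp (Primrec.const 2)
    (primrec_mul Primrec.snd Primrec.snd)) ?_
  refine primrecPred_exists_lt (primrec_pow.comp (Primrec.snd.comp Primrec.fst)
    (Primrec.snd.comp Primrec.fst)) ?_
  refine primrecPred_exists_lt (primrec_pow.comp (Primrec.const 2) (primrec_mul
    (Primrec.snd.comp (Primrec.fst.comp Primrec.fst))
    (Primrec.succ.comp (Primrec.fst.comp (Primrec.fst.comp Primrec.fst))))) ?_
  exact primrecPred_isCountermodel

theorem primrec_code : Primrec Formula.code := Primrec.of_equiv (e := Formula.codeEquiv)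

/-- A state refuting `φ → ⊥` need not satisfy `φ` itself, but some state above it does. -/
theorem satisfiable_iff (φ : Formula) :
    Formula.Satisfiable.{u} φ ↔ ¬ Formula.Valid.{u} (.imp φ .bot) := by
  constructor
  · rintro ⟨W, _, _, M, w, h⟩ hv
    exact hv W M w w le_rfl h
  · intro h
    simp only [Formula.Valid, not_forall] at h
    obtain ⟨W, _, _, M, w, h⟩ := h
    simp only [Model.Sat, not_forall] at h
    obtain ⟨v, -, hv, -⟩ := h
    exact ⟨W, _, _, M, v, hv⟩

theorem primrecPred_valid : PrimrecPred Formula.Valid.{u} :=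
  (primrecPred_hasCountermodel.comp primrec_code).not.of_eq fun φ => (valid_iff φ).symm

theorem primrecPred_satisfiable : PrimrecPred Formula.Satisfiable.{u} := by
  have h : Primrec fun φ : Formula => (Formula.imp φ .bot).code :=
    primrec_add (primrec_mul (Primrec.const 9)
      (Primrec₂.natPair.comp primrec_code (Primrec.const 0))) (Primrec.const 4)
  refine (primrecPred_hasCountermodel.comp h).of_eq fun φ => ?_
  rw [satisfiable_iff, valid_iff, not_not]

end ITL

theorem mainTheorem2 :
    ComputablePred ITL.Formula.Satisfiable.{u} ∧ ComputablePred ITL.Formula.Valid.{u} :=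
  ⟨ITL.primrecPred_satisfiable.computablePred, ITL.primrecPred_valid.computablePred⟩
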